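/- Let $V$ be a nonempty finite set. Let $\mathbb{S}^V$ be the space of symmetric real $V\times V$ matrices with $\langle X,Y\rangle=\operatorname{tr}(XY^{\mathsf T})$, $\mathbb{S}^V_+$ its cone of positive semidefinite matrices, and $\mathbb{K}^*=\{Y\in\mathbb{S}^V:\langle X,Y\rangle\ge 0\ \forall X\in\mathbb{K}\}$ for $\mathbb{K}\subseteq\mathbb{S}^V$. A set $\mathbb{K}\subseteq\mathbb{S}^V$ is *diagonally scaling-invariant* if $\operatorname{Diag}(h)X\operatorname{Diag}(h)\in\mathbb{K}$ for all $X\in\mathbb{K}$ and $h\in\mathbb{R}^V_+$. With $0\notin V$, for $\mathbb{A}\subseteq\mathbb{S}^V$ and $\widehat{\mathbb{K}}\subseteq\mathbb{S}^{\{0\}\cup V}$ put $$\mathrm{TH}(\mathbb{A},\widehat{\mathbb{K}})=\{\operatorname{diag}(\hat X[V]) : \hat X\in\widehat{\mathbb{K}},\ \hat X_{00}=1,\ \hat Xe_0=\operatorname{diag}(\hat X),\ \hat X[V]\in\mathbb{A}\}.$$ For $\mathbb{K}\subseteq\mathbb{S}^V$ put $\mathrm{Psd}(\mathbb{K})=\{\hat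 X\in\mathbb{S}^{\{0\}\cup V}_+:\hat X[V]\in\mathbb{K}\}$ and $$\mathrm{Schur}(\mathbb{K})=\left\{\begin{bmatrix}x_0&x^{\mathsf T}\\x&X\end{bmatrix}\in\mathbb{S}^{\{0\}\cup V} : X\in\mathbb{K},\ x_0\ge 0,\ x_0X-xx^{\mathsf T}\in\mathbb{K}\right\}.$$ For $\mathbb{A}\subseteq\mathbb{S}^V$ put $\mathbb{A}^\circ=\operatorname{Im}(\operatorname{Diag})-\mathbb{A}^*$. For $C\subseteq\mathbb{R}^V$ let $\operatorname{abl}(C)=\{y\in\mathbb{R}^V_+:\langle y,x\rangle\le 1\ \forall x\in C\}$ and $\delta^*(w\mid C)=\sup_{x\in C}\langle w,x\rangle$. Let $\mathbb{A}\subseteq\mathbb{S}^V$ be a diagonally scaling-invariant polyhedral cone containing all diagonal matrices, and let $\mathbb{K}\subseteq\mathbb{S}^V_+$ be a diagonally scaling-invariant closed convex cone containing all nonnegative diagonal matrices and having nonempty interior in $\mathbb{S}^V$. Put $B=\mathrm{TH}(\mathbb{A}^\circ,\mathrm{Schur}(\mathbb{K}^*))$. For $w\in\mathbb{R}^V_+$,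 with $\sqrt w$ the componentwise square root, define $$\theta=\delta^*(w\mid\operatorname{abl}(\operatorname{cl}B)),\qquad \theta_1=\inf\Big\{\max_{i\in V}\tfrac{w_i}{x_i}:x\in\operatorname{cl}B\Big\},$$ $$\theta_2=\inf\{\lambda\in\mathbb{R}:\ \lambda I-Y-\sqrt w\sqrt w^{\mathsf T}\in\mathbb{K}^*,\ -Y\in\mathbb{A}^\circ,\ \operatorname{diag}(Y)=0\},$$ $$\theta_3=\sup\{\sqrt w^{\mathsf T}X\sqrt w:\ \operatorname{tr}X=1,\ X\in\mathbb{K}\cap\mathbb{A}\},\qquad \theta_4=\delta^*(w\mid\mathrm{TH}(\mathbb{A},\mathrm{Psd}(\mathbb{K}))),$$ where in $\theta_1$ the fraction $w_i/x_i$ is $0$ if $w_i=0$ and $+\infty$ if $w_i>0=x_i$. Then: 1. For every $w\in\mathbb{R}^V_+$, $\theta=\theta_1=\theta_2=\theta_3=\theta_4$. The optimization problems defining $\theta,\theta_1,\theta_3,\theta_4$ have optimal solutions, and the one defining $\theta_2$ has an optimal solution if $B$ is closed. 2. $\operatorname{abl}(\operatorname{cl}B)=\mathrm{TH}(\mathbb{A},\mathrm{Psd}(\mathbb{K}))$.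 Moreover, for every graph $G=(V,E)$ with complement $\overline G=(V,\overline E)$, $$\operatorname{abl}(\mathrm{TH}(G))=\mathrm{TH}(\overline G),\qquad \operatorname{abl}(\mathrm{TH}'(G))=\mathrm{TH}^+(\overline G),$$ where, with $\mathbb{A}_{E^+,E^-}=\{X\in\mathbb{S}^V:X_{ij}\ge0\ \forall ij\in E^+,\ X_{ij}\le0\ \forall ij\in E^-\}$, we set $\mathrm{TH}(G)=\mathrm{TH}(\mathbb{A}_{E,E},\mathbb{S}_+^{\{0\}\cup V})$, $\mathrm{TH}'(G)=\mathrm{TH}(\mathbb{A}_{E\cup\overline E,E},\mathbb{S}_+^{\{0\}\cup V})$ and $\mathrm{TH}^+(G)=\mathrm{TH}(\mathbb{A}_{\emptyset,E},\mathbb{S}_+^{\{0\}\cup V})$. -/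

import Mathlib

open scoped Pointwise

noncomputable section

namespace ThetaBody

variable {V : Type*}

/-! Subsets of the space of symmetric `V × V` matrices are sets of matrices all of whose members
are symmetric. The index set `{0} ∪ V` is `Option V`, with `none` in the role of `0`. -/

/-- The space of symmetric matrices. -/
def symSet (V : Type*) : Set (Matrix V V ℝ) := {X | X.IsSymm}

/-- The cone of symmetric positive semidefinite matrices. -/
def psdCone (V : Type*) : Set (Matrix V V ℝ) := {X | X.PosSemidef}

/-- The interior of `K`, taken relative to the space of symmetric matrices, is nonempty. -/
def HasSymInterior (K : Set (Matrix V V ℝ)) : Prop :=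
  (interior {X : symSet V | (X : Matrix V V ℝ) ∈ K}).Nonempty

section Cones

variable [Fintype V]

/-- The trace inner product. -/
def inp (X Y : Matrix V V ℝ) : ℝ := (X * Y.transpose).trace

/-- The dual cone, in the space of symmetric matrices. -/
def dualCone (K : Set (Matrix V V ℝ)) : Set (Matrix V V ℝ) :=
  {Y | Y ∈ symSet V ∧ ∀ X ∈ K, 0 ≤ inp X Y}

/-- A polyhedral cone in the space of symmetric matrices: an intersection of finitely many
closed linear half-spaces. -/
def IsPolyhedralCone (A : Set (Matrix V V ℝ)) : Prop :=
  ∃ S : Set (Matrix V V ℝ), S.Finite ∧ S ⊆ symSet V ∧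
    A = {X | X ∈ symSet V ∧ ∀ H ∈ S, 0 ≤ inp H X}

variable [DecidableEq V]

/-- Closed under `X ↦ Diag(h) X Diag(h)` for every nonnegative `h`. Constant `h` show that such a
set is closed under multiplication by nonnegative scalars. -/
def DiagScalingInvariant (K : Set (Matrix V V ℝ)) : Prop :=
  ∀ h : V → ℝ, 0 ≤ h → ∀ X ∈ K, Matrix.diagonal h * X * Matrix.diagonal h ∈ K

/-- The dual `Image(Diag) - A*` of an adjacency cone, `A*` being the dual cone. -/
def adjDual (A : Set (Matrix V V ℝ)) : Set (Matrix V V ℝ) :=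
  Set.range (Matrix.diagonal : (V → ℝ) → Matrix V V ℝ) - dualCone A

end Cones

/-- The principal submatrix on `V` of a matrix on `{0} ∪ V`. -/
def corner (X : Matrix (Option V) (Option V) ℝ) : Matrix V V ℝ := X.submatrix some some

/-- The PSD lifting. -/
def psdLift (K : Set (Matrix V V ℝ)) : Set (Matrix (Option V) (Option V) ℝ) :=
  {X | X ∈ psdCone (Option V) ∧ corner X ∈ K}

/-- The Schur lifting: symmetric `[x₀, xᵀ; x, X]` with `X ∈ K`, `x₀ ≥ 0`, `x₀ X - x xᵀ ∈ K`. -/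
def schurLift (K : Set (Matrix V V ℝ)) : Set (Matrix (Option V) (Option V) ℝ) :=
  {X | X ∈ symSet (Option V) ∧ corner X ∈ K ∧ 0 ≤ X none none ∧
    X none none • corner X
      - Matrix.vecMulVec (fun i => X (some i) none) (fun i => X (some i) none) ∈ K}

/-- The lifted theta body: `X ∈ K` with `X₀₀ = 1`, `X e₀ = diag(X)`, `X[V] ∈ A`. -/
def liftedTH (A : Set (Matrix V V ℝ)) (K : Set (Matrix (Option V) (Option V) ℝ)) :
    Set (Matrix (Option V) (Option V) ℝ) :=
  {X | X ∈ K ∧ X none none = 1 ∧ X.col none = X.diag ∧ corner X ∈ A}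

/-- The theta body `TH(A, K)`. -/
def genTH (A : Set (Matrix V V ℝ)) (K : Set (Matrix (Option V) (Option V) ℝ)) : Set (V → ℝ) :=
  (fun X => (corner X).diag) '' liftedTH A K

/-- The symmetric matrices with `X i j ≥ 0` for `ij ∈ Ep` and `X i j ≤ 0` for `ij ∈ En`. -/
def polyAdjCone (Ep En : Set (Sym2 V)) : Set (Matrix V V ℝ) :=
  {X | X ∈ symSet V ∧ (∀ i j, s(i, j) ∈ Ep → 0 ≤ X i j) ∧ (∀ i j, s(i, j) ∈ En → X i j ≤ 0)}

/-- The theta body of a graph. -/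
def graphTH (G : SimpleGraph V) : Set (V → ℝ) :=
  genTH (polyAdjCone G.edgeSet G.edgeSet) (psdCone (Option V))

/-- The variant `TH'` of the theta body of a graph. -/
def graphTHPrime (G : SimpleGraph V) : Set (V → ℝ) :=
  genTH (polyAdjCone (G.edgeSet ∪ Gᶜ.edgeSet) G.edgeSet) (psdCone (Option V))

/-- The variant `TH⁺` of the theta body of a graph. -/
def graphTHPlus (G : SimpleGraph V) : Set (V → ℝ) :=
  genTH (polyAdjCone ∅ G.edgeSet) (psdCone (Option V))

section Parameters

variable [Fintype V]

/-- The antiblocker. -/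
def abl (C : Set (V → ℝ)) : Set (V → ℝ) := {y | 0 ≤ y ∧ ∀ x ∈ C, y ⬝ᵥ x ≤ 1}

/-- The linear objective `x ↦ ⟨w, x⟩`. -/
def linObj (w x : V → ℝ) : EReal := ((w ⬝ᵥ x : ℝ) : EReal)

/-- The support function. -/
def suppFn (C : Set (V → ℝ)) (w : V → ℝ) : EReal := ⨆ x ∈ C, linObj w x

/-- The fraction `a / b` of nonnegative reals, with `0 / b = 0` even if `b = 0`, and
`a / 0 = +∞` if `a > 0`. -/
def extDiv (a b : ℝ) : EReal := if a = 0 then 0 else if b = 0 then ⊤ else ((a / b : ℝ) : EReal)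

/-- The objective `x ↦ max_i w_i / x_i`. -/
def maxRatio (w x : V → ℝ) : EReal := ⨆ i, extDiv (w i) (x i)

/-- The componentwise square root. -/
def sqrtVec (w : V → ℝ) : V → ℝ := fun i => √(w i)

/-- The objective `X ↦ √wᵀ X √w`. -/
def quadObj (w : V → ℝ) (X : Matrix V V ℝ) : EReal :=
  ((sqrtVec w ⬝ᵥ X.mulVec (sqrtVec w) : ℝ) : EReal)

variable [DecidableEq V]

/-- The body `TH(Image(Diag) - A*, Schur(K*))`. -/
def dualBody (A K : Set (Matrix V V ℝ)) : Set (V → ℝ) :=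
  genTH (adjDual A) (schurLift (dualCone K))

/-- The feasible pairs `(lam, Y)` of the problem that defines `theta2`:
`lam I - (Y + √w √wᵀ) ∈ K*`, `-Y ∈ adjDual A`, `diag(Y) = 0`. -/
def theta2Feasible (A K : Set (Matrix V V ℝ)) (w : V → ℝ) : Set (ℝ × Matrix V V ℝ) :=
  {p | p.1 • (1 : Matrix V V ℝ) - (p.2 + Matrix.vecMulVec (sqrtVec w) (sqrtVec w)) ∈ dualCone K ∧
    -p.2 ∈ adjDual A ∧ p.2.diag = 0}

/-- The feasible set of the problem that defines `theta3`. -/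
def theta3Feasible (A K : Set (Matrix V V ℝ)) : Set (Matrix V V ℝ) :=
  {X | X.trace = 1 ∧ X ∈ K ∧ X ∈ A}

/-- The parameter `θ(A, K; w)`. -/
def theta (A K : Set (Matrix V V ℝ)) (w : V → ℝ) : EReal :=
  suppFn (abl (closure (dualBody A K))) w

/-- The parameter `θ₁(A, K; w)`. -/
def theta1 (A K : Set (Matrix V V ℝ)) (w : V → ℝ) : EReal :=
  ⨅ x ∈ closure (dualBody A K), maxRatio w x

/-- The parameter `θ₂(A, K; w)`. -/
def theta2 (A K : Set (Matrix V V ℝ)) (w : V → ℝ) : EReal :=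
  ⨅ p ∈ theta2Feasible A K w, (p.1 : EReal)

/-- The parameter `θ₃(A, K; w)`. -/
def theta3 (A K : Set (Matrix V V ℝ)) (w : V → ℝ) : EReal :=
  ⨆ X ∈ theta3Feasible A K, quadObj w X

/-- The parameter `θ₄(A, K; w)`. -/
def theta4 (A K : Set (Matrix V V ℝ)) (w : V → ℝ) : EReal :=
  suppFn (genTH A (psdLift K)) w

end Parameters

end ThetaBody

end

/-! Membership in `dualBody A K` means `Diag(x) - N - x xᵀ ∈ K*` for some `N ∈ A*`, and feasibility
for `theta2` means `λI - Y - √w √wᵀ ∈ K*` with `Y ∈ A*`. Diagonal scaling turns one condition into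
the other: scaling by `√w / λ` sends a feasible `λ > 0` to the point `w / λ`, and scaling by `√w /
x` goes back (`inv_smul_mem_dualBody`, `exists_mem_theta2Feasible`). This identifies the gauge
problem `theta1` with `theta2`, up to closure.

`theta2` and `theta3` are conic duals. The bipolar theorem only gives the closure of `K* + A*`, but
`K ⊆ S₊` puts `S₊` inside `K*`, so any `εI` absorbs the closure error (`exists_add_smul_one`).

A feasible `X` of `theta3` becomes a point of the theta body by scaling the rank-one downdate of `X`
along `√w`; Cauchy–Schwarz shows that the objective does not drop (`exists_mem_genTH_quad_le`).
Conversely, pairing the two defining matrices gives `⟨x, y⟩² ≤ ⟨x, y⟩` for `x` in the dual body and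
`y` in the theta body (`genTH_subset_abl`). Since the theta body is convex, compact and closed under
coordinatewise shrinking, separation upgrades this to `abl_dualBody`. The graph identities are the
case `K = S₊`, where the dual body is again a theta body with complementary sign patterns. -/

namespace ThetaBody

open Matrix

/-! ### The trace inner product. -/

section TraceForm

variable {V : Type*} [Fintype V]

theorem inp_eq_sum (X Y : Matrix V V ℝ) : inp X Y = ∑ i, ∑ j, X i j * Y i j := by
  simp [inp, Matrix.trace, Matrix.mul_apply]

theorem inp_comm (X Y : Matrix V V ℝ) : inp X Y = inp Y X := by
  simp [inp_eq_sum, mul_comm]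

theorem inp_add_right (X Y Z : Matrix V V ℝ) : inp X (Y + Z) = inp X Y + inp X Z := by
  simp [inp_eq_sum, mul_add, Finset.sum_add_distrib]

theorem inp_sub_right (X Y Z : Matrix V V ℝ) : inp X (Y - Z) = inp X Y - inp X Z := by
  simp [inp_eq_sum, mul_sub, Finset.sum_sub_distrib]

theorem inp_neg_right (X Y : Matrix V V ℝ) : inp X (-Y) = -inp X Y := by
  simp [inp_eq_sum]

theorem inp_smul_right (c : ℝ) (X Y : Matrix V V ℝ) : inp X (c • Y) = c * inp X Y := by
  simp [inp_eq_sum, Finset.mul_sum, mul_left_comm]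

theorem inp_zero_right (X : Matrix V V ℝ) : inp X 0 = 0 := by
  simp [inp_eq_sum]

theorem inp_transpose_right {X : Matrix V V ℝ} (hX : X.IsSymm) (Y : Matrix V V ℝ) :
    inp X Yᵀ = inp X Y := by
  rw [inp_eq_sum, inp_eq_sum, Finset.sum_comm]
  simp only [Matrix.transpose_apply, hX.apply]

theorem inp_vecMulVec (X : Matrix V V ℝ) (v : V → ℝ) :
    inp X (vecMulVec v v) = v ⬝ᵥ X *ᵥ v := by
  simp only [inp_eq_sum, vecMulVec_apply, dotProduct, mulVec, Finset.mul_sum]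
  exact Finset.sum_congr rfl fun i _ => Finset.sum_congr rfl fun j _ => by ring

theorem continuous_inp_right (X : Matrix V V ℝ) : Continuous fun Y => inp X Y := by
  unfold inp
  fun_prop

theorem inp_diagonal [DecidableEq V] (X : Matrix V V ℝ) (d : V → ℝ) :
    inp X (diagonal d) = d ⬝ᵥ X.diag := by
  simp [inp_eq_sum, diagonal_apply, dotProduct, mul_comm]

theorem inp_one [DecidableEq V] (X : Matrix V V ℝ) : inp X 1 = X.trace := by
  simp [inp]

theorem diagonal_mul_mul_diagonal_apply [DecidableEq V] (h : V → ℝ) (X : Matrix V V ℝ) (i j : V) :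
    (diagonal h * X * diagonal h) i j = h i * X i j * h j := by
  simp

theorem inp_diagonal_conj [DecidableEq V] (h : V → ℝ) (X Y : Matrix V V ℝ) :
    inp X (diagonal h * Y * diagonal h) = inp (diagonal h * X * diagonal h) Y := by
  simp only [inp_eq_sum, diagonal_mul_mul_diagonal_apply]
  exact Finset.sum_congr rfl fun i _ => Finset.sum_congr rfl fun j _ => by ring

end TraceForm

/-! ### Positive semidefinite matrices. -/

section PositiveSemidefinite

variable {V : Type*}

theorem isSymm_of_posSemidef {X : Matrix V V ℝ} (hX : X.PosSemidef) : X.IsSymm := by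
  have := hX.1
  rwa [Matrix.IsHermitian, conjTranspose_eq_transpose_of_trivial] at this

theorem psdCone_subset_symSet : psdCone V ⊆ symSet V := fun _ hX => isSymm_of_posSemidef hX

theorem isSymm_vecMulVec_self (v : V → ℝ) : (vecMulVec v v).IsSymm := by
  ext i j
  simp [vecMulVec_apply, mul_comm]

theorem convex_psdCone : Convex ℝ (psdCone V) := fun _ hX _ hY _ _ ha hb _ =>
  (Matrix.PosSemidef.smul hX ha).add (Matrix.PosSemidef.smul hY hb)

theorem posSemidef_vecMulVec [Fintype V] (v : V → ℝ) : (vecMulVec v v).PosSemidef := by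
  simpa using posSemidef_vecMulVec_self_star v

variable [Fintype V]

theorem posSemidef_iff_isSymm {X : Matrix V V ℝ} :
    X.PosSemidef ↔ X.IsSymm ∧ ∀ v : V → ℝ, 0 ≤ v ⬝ᵥ X *ᵥ v := by
  rw [posSemidef_iff_dotProduct_mulVec, Matrix.IsHermitian,
    conjTranspose_eq_transpose_of_trivial]
  simp [Matrix.IsSymm]

theorem inp_nonneg_of_posSemidef {X Y : Matrix V V ℝ} (hX : X.PosSemidef) (hY : Y.PosSemidef) :
    0 ≤ inp X Y := by
  obtain ⟨m, v, rfl⟩ := posSemidef_iff_eq_sum_vecMulVec.1 hY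
  have : inp X (∑ i, vecMulVec (v i) (star (v i))) = ∑ i, v i ⬝ᵥ X *ᵥ v i := by
    simp only [← inp_vecMulVec, inp_eq_sum, Matrix.sum_apply, Finset.mul_sum, star_trivial]
    rw [Finset.sum_comm]
    refine (Finset.sum_congr rfl fun i _ => Finset.sum_comm).trans ?_
    rw [Finset.sum_comm]
    refine Finset.sum_congr rfl fun i _ => Finset.sum_comm
  rw [this]
  exact Finset.sum_nonneg fun i _ => (posSemidef_iff_isSymm.1 hX).2 _

theorem sq_dotProduct_le_of_posSemidef_sub {X : Matrix V V ℝ} {x : V → ℝ}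
    (hX : (X - vecMulVec x x).PosSemidef) (v : V → ℝ) : (v ⬝ᵥ x) ^ 2 ≤ v ⬝ᵥ X *ᵥ v := by
  have := (posSemidef_iff_isSymm.1 hX).2 v
  rw [sub_mulVec, dotProduct_sub, vecMulVec_mulVec, op_smul_eq_smul, dotProduct_smul,
    smul_eq_mul, dotProduct_comm x v] at this
  linarith

theorem dualCone_psdCone : dualCone (psdCone V) = psdCone V := by
  ext Y
  refine ⟨fun ⟨hs, h⟩ => posSemidef_iff_isSymm.2 ⟨hs, fun v => ?_⟩, fun hY =>
    ⟨isSymm_of_posSemidef hY, fun X hX => inp_nonneg_of_posSemidef hX hY⟩⟩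
  rw [← inp_vecMulVec, inp_comm]
  exact h _ (posSemidef_vecMulVec v)

theorem isClosed_psdCone : IsClosed (psdCone V) := by
  have : psdCone V = {X | Xᵀ = X} ∩ ⋂ v : V → ℝ, {X | 0 ≤ v ⬝ᵥ X *ᵥ v} := by
    ext X
    simp [psdCone, posSemidef_iff_isSymm, Matrix.IsSymm]
  rw [this]
  refine (isClosed_eq (by fun_prop) continuous_id).inter (isClosed_iInter fun v => ?_)
  exact isClosed_le continuous_const (by fun_prop)

theorem posSemidef_diagonal_conj [DecidableEq V] {X : Matrix V V ℝ} (hX : X.PosSemidef)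
    (h : V → ℝ) : (diagonal h * X * diagonal h).PosSemidef := by
  simpa [diagonal_conjTranspose] using hX.conjTranspose_mul_mul_same (diagonal h)

/-- The Cauchy–Schwarz inequality for the form of a positive semidefinite matrix. -/
theorem sq_dotProduct_mulVec_le {X : Matrix V V ℝ} (hX : X.PosSemidef) (u v : V → ℝ) :
    (u ⬝ᵥ X *ᵥ v) ^ 2 ≤ (u ⬝ᵥ X *ᵥ u) * (v ⬝ᵥ X *ᵥ v) := by
  obtain ⟨hs, hn⟩ := posSemidef_iff_isSymm.1 hX
  have hsym : v ⬝ᵥ X *ᵥ u = u ⬝ᵥ X *ᵥ v := by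
    rw [dotProduct_mulVec, ← mulVec_transpose, hs.eq, dotProduct_comm]
  have key : ∀ t : ℝ, 0 ≤ (u ⬝ᵥ X *ᵥ u) * (t * t) + (2 * (u ⬝ᵥ X *ᵥ v)) * t + v ⬝ᵥ X *ᵥ v := by
    intro t
    have := hn (t • u + v)
    simp only [mulVec_add, mulVec_smul, dotProduct_add, add_dotProduct, smul_dotProduct,
      dotProduct_smul, smul_eq_mul, hsym] at this
    linarith
  have := discrim_le_zero key
  rw [discrim] at this
  linarith

/-- Rank-one downdate: `X - (X v)(X v)ᵀ / (vᵀ X v)` is positive semidefinite. -/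
theorem posSemidef_sub_vecMulVec_mulVec {X : Matrix V V ℝ} (hX : X.PosSemidef) (v : V → ℝ) :
    (X - (v ⬝ᵥ X *ᵥ v)⁻¹ • vecMulVec (X *ᵥ v) (X *ᵥ v)).PosSemidef := by
  have hs := isSymm_of_posSemidef hX
  refine posSemidef_iff_isSymm.2 ⟨hs.sub ((isSymm_vecMulVec_self _).smul _), fun u => ?_⟩
  have h1 := sq_dotProduct_mulVec_le hX u v
  have h2 := (posSemidef_iff_isSymm.1 hX).2 v
  have h3 := (posSemidef_iff_isSymm.1 hX).2 u
  have : u ⬝ᵥ (X - (v ⬝ᵥ X *ᵥ v)⁻¹ • vecMulVec (X *ᵥ v) (X *ᵥ v)) *ᵥ u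
      = u ⬝ᵥ X *ᵥ u - (v ⬝ᵥ X *ᵥ v)⁻¹ * (u ⬝ᵥ X *ᵥ v) ^ 2 := by
    simp only [sub_mulVec, smul_mulVec, dotProduct_sub, dotProduct_smul, vecMulVec_mulVec,
      op_smul_eq_smul, smul_eq_mul, dotProduct_comm (X *ᵥ v) u]
    ring
  rw [this]
  rcases h2.eq_or_lt with h0 | h0
  · simpa [← h0] using h3
  · rw [inv_mul_eq_div, sub_nonneg, div_le_iff₀ h0]
    exact h1

theorem sq_le_diag_mul_diag [DecidableEq V] {X : Matrix V V ℝ} (hX : X.PosSemidef) (i j : V) :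
    X i j ^ 2 ≤ X i i * X j j := by
  simpa using sq_dotProduct_mulVec_le hX (Pi.single i 1) (Pi.single j 1)

/-- Each term satisfies `v i * E i j * v j ≥ -δ (v i² + v j²) / 2`, and these bounds add up to `-n δ
‖v‖²`, with `n` the number of indices. -/
theorem posSemidef_add_smul_one [DecidableEq V] {E : Matrix V V ℝ} (hE : E.IsSymm) {δ ε : ℝ}
    (hδ : ∀ i j, |E i j| ≤ δ) (hε : Fintype.card V * δ ≤ ε) :
    (E + ε • (1 : Matrix V V ℝ)).PosSemidef := by
  refine posSemidef_iff_isSymm.2 ⟨hE.add (isSymm_one.smul ε), fun v => ?_⟩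
  have h1 : -(Fintype.card V * δ * ∑ i, v i ^ 2) ≤ v ⬝ᵥ E *ᵥ v := by
    have : ∀ i j, -(δ * (v i ^ 2 + v j ^ 2) / 2) ≤ v i * (E i j * v j) := fun i j => by
      obtain ⟨h1, h2⟩ := abs_le.1 (hδ i j)
      nlinarith [sq_nonneg (v i + v j), sq_nonneg (v i - v j),
        mul_nonneg (sub_nonneg.2 h2) (sq_nonneg (v i - v j)),
        mul_nonneg (neg_le_iff_add_nonneg.1 h1) (sq_nonneg (v i + v j))]
    simp only [dotProduct, mulVec, Finset.mul_sum]
    refine le_trans (le_of_eq ?_) (Finset.sum_le_sum fun i _ => Finset.sum_le_sum fun j _ =>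
      this i j)
    simp only [Finset.sum_neg_distrib, ← Finset.sum_div, ← Finset.mul_sum,
      Finset.sum_add_distrib, Finset.sum_const, Finset.card_univ, nsmul_eq_mul]
    ring
  have h2 : v ⬝ᵥ (E + ε • (1 : Matrix V V ℝ)) *ᵥ v = v ⬝ᵥ E *ᵥ v + ε * ∑ i, v i ^ 2 := by
    rw [add_mulVec, smul_mulVec, dotProduct_add, dotProduct_smul, one_mulVec]
    simp [dotProduct, sq]
  have h3 : 0 ≤ ∑ i, v i ^ 2 := Finset.sum_nonneg fun i _ => sq_nonneg _
  rw [h2]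
  nlinarith [mul_le_mul_of_nonneg_right hε h3]

/-- The bound `X i j ^ 2 ≤ X i i * X j j` extends the diagonal bound to every entry. -/
theorem isCompact_posSemidef_of_diag_le (C : Set (Matrix V V ℝ)) (hC : IsClosed C)
    (hpsd : C ⊆ psdCone V) (hd : ∀ X ∈ C, ∀ i, X i i ≤ 1) : IsCompact C := by
  classical
  have hbox : IsCompact {X : Matrix V V ℝ | ∀ i j, X i j ∈ Set.Icc (-1 : ℝ) 1} := by
    have h := isCompact_univ_pi (fun _ : V => isCompact_univ_pi (fun _ : V =>
      isCompact_Icc (a := (-1 : ℝ)) (b := 1)))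
    simp only [Set.pi, Set.mem_univ, true_imp_iff] at h
    exact h
  refine hbox.of_isClosed_subset hC fun X hX i j => ?_
  have h := sq_le_diag_mul_diag (hpsd hX) i j
  have h1 : X i i * X j j ≤ 1 :=
    mul_le_one₀ (hd X hX i) (Matrix.PosSemidef.diag_nonneg (hpsd hX)) (hd X hX j)
  exact abs_le.1 ((sq_le_one_iff_abs_le_one _).1 (h.trans h1))

end PositiveSemidefinite

/-! ### Separation of a matrix from a closed convex cone. -/

section Separation

variable {V : Type*} [Fintype V]

theorem exists_inp_eq [DecidableEq V] (f : Matrix V V ℝ →ₗ[ℝ] ℝ) :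
    ∃ Y : Matrix V V ℝ, ∀ X, f X = inp X Y := by
  refine ⟨Matrix.of fun i j => f (Matrix.single i j 1), fun X => ?_⟩
  conv_lhs => rw [Matrix.matrix_eq_sum_single X]
  simp only [map_sum, inp_eq_sum, of_apply]
  refine Finset.sum_congr rfl fun i _ => Finset.sum_congr rfl fun j _ => ?_
  rw [show Matrix.single i j (X i j) = X i j • Matrix.single i j (1 : ℝ) by simp, map_smul,
    smul_eq_mul]

/-- A symmetric matrix outside a closed convex cone `C` of symmetric matrices is separated
from `C` by a member of the dual cone. -/
theorem exists_mem_dualCone_inp_neg {C : Set (Matrix V V ℝ)} (hs : C ⊆ symSet V)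
    (hcl : IsClosed C) (hcv : Convex ℝ C) (h0 : (0 : Matrix V V ℝ) ∈ C)
    (hsmul : ∀ c : ℝ, 0 ≤ c → ∀ X ∈ C, c • X ∈ C)
    {M : Matrix V V ℝ} (hM : M ∈ symSet V) (hMC : M ∉ C) :
    ∃ Y ∈ dualCone C, inp M Y < 0 := by
  classical
  have : LocallyConvexSpace ℝ (Matrix V V ℝ) :=
    inferInstanceAs (LocallyConvexSpace ℝ (V → V → ℝ))
  obtain ⟨f, u, hfM, hfC⟩ := geometric_hahn_banach_point_closed hcv hcl hMC
  obtain ⟨Z, hZ⟩ := exists_inp_eq f.toLinearMap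
  have hZ' : ∀ X, f X = inp X Z := hZ
  have hu : u < 0 := by simpa using hfC 0 h0
  -- The matrix `Z` representing the functional need not be symmetric; symmetrising it only doubles
  -- the values on symmetric matrices.
  have hsymm : ∀ X ∈ symSet V, inp X (Z + Zᵀ) = 2 * f X := fun X hX => by
    rw [inp_add_right, inp_transpose_right hX, hZ']; ring
  refine ⟨Z + Zᵀ, ⟨isSymm_add_transpose_self Z, fun X hX => ?_⟩, ?_⟩
  · rw [hsymm X (hs hX)]
    by_contra hneg
    have hneg : f X < 0 := by linarith
    -- Rescaling `X` by `u / f X` makes `f` equal to `u`, against the strict separation `u < f` on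
    -- `C`.
    have hpos : 0 ≤ u / f X := (div_pos_of_neg_of_neg hu hneg).le
    have := hfC _ (hsmul _ hpos X hX)
    rw [map_smul, smul_eq_mul, div_mul_cancel₀ _ hneg.ne] at this
    exact lt_irrefl _ this
  · rw [hsymm M hM]
    linarith

end Separation

/-! ### Dual cones and diagonal scaling. -/

section DualCone

variable {V : Type*} [Fintype V] {C : Set (Matrix V V ℝ)}

theorem dualCone_add {Y Z : Matrix V V ℝ} (hY : Y ∈ dualCone C) (hZ : Z ∈ dualCone C) :
    Y + Z ∈ dualCone C :=
  ⟨Matrix.IsSymm.add hY.1 hZ.1, fun X hX => by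
    rw [inp_add_right]; exact add_nonneg (hY.2 X hX) (hZ.2 X hX)⟩

theorem dualCone_smul {c : ℝ} (hc : 0 ≤ c) {Y : Matrix V V ℝ} (hY : Y ∈ dualCone C) :
    c • Y ∈ dualCone C :=
  ⟨Matrix.IsSymm.smul hY.1 c, fun X hX => by
    rw [inp_smul_right]; exact mul_nonneg hc (hY.2 X hX)⟩

theorem zero_mem_dualCone : (0 : Matrix V V ℝ) ∈ dualCone C :=
  ⟨Matrix.isSymm_zero, fun X _ => by rw [inp_zero_right]⟩

theorem psdCone_subset_dualCone (hC : C ⊆ psdCone V) : psdCone V ⊆ dualCone C := fun _ hY =>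
  ⟨isSymm_of_posSemidef hY, fun _ hX => inp_nonneg_of_posSemidef (hC hX) hY⟩

variable [DecidableEq V]

theorem isSymm_diagonal_conj {X : Matrix V V ℝ} (hX : X.IsSymm) (h : V → ℝ) :
    (diagonal h * X * diagonal h).IsSymm := by
  ext i j
  simp only [transpose_apply, diagonal_mul_mul_diagonal_apply, hX.apply i j]
  ring

theorem DiagScalingInvariant.dualCone (hC : DiagScalingInvariant C) :
    DiagScalingInvariant (dualCone C) := fun h hh Y hY =>
  ⟨isSymm_diagonal_conj hY.1 h, fun X hX => by
    rw [inp_diagonal_conj]; exact hY.2 _ (hC h hh X hX)⟩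

theorem DiagScalingInvariant.smul_mem (hC : DiagScalingInvariant C) {c : ℝ} (hc : 0 ≤ c)
    {X : Matrix V V ℝ} (hX : X ∈ C) : c • X ∈ C := by
  have := hC (fun _ => √c) (fun _ => Real.sqrt_nonneg c) X hX
  convert this using 1
  ext i j
  rw [diagonal_mul_mul_diagonal_apply, Matrix.smul_apply, smul_eq_mul, mul_right_comm,
    Real.mul_self_sqrt hc]

theorem diag_eq_zero_of_mem_dualCone (hC : Set.range (diagonal : (V → ℝ) → Matrix V V ℝ) ⊆ C)
    {Y : Matrix V V ℝ} (hY : Y ∈ dualCone C) : Y.diag = 0 := by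
  ext i
  have h1 := hY.2 _ (hC ⟨Pi.single i 1, rfl⟩)
  have h2 := hY.2 _ (hC ⟨-Pi.single i 1, rfl⟩)
  rw [inp_comm, inp_diagonal] at h1 h2
  simp only [neg_dotProduct, single_dotProduct, one_mul] at h1 h2
  exact le_antisymm (by simpa using h2) (by simpa using h1)

theorem diag_nonneg_of_mem_dualCone (hC : ∀ d : V → ℝ, 0 ≤ d → diagonal d ∈ C)
    {Y : Matrix V V ℝ} (hY : Y ∈ dualCone C) (i : V) : 0 ≤ Y i i := by
  have h := hY.2 _ (hC (Pi.single i 1) (Pi.single_nonneg.2 zero_le_one))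
  rw [inp_comm, inp_diagonal] at h
  simpa using h

end DualCone

/-! ### Polyhedral cones. -/

section PolyhedralCone

variable {V : Type*} [Fintype V] {A : Set (Matrix V V ℝ)}

theorem IsPolyhedralCone.isClosed (hA : IsPolyhedralCone A) : IsClosed A := by
  obtain ⟨S, -, -, rfl⟩ := hA
  have : {X | X ∈ symSet V ∧ ∀ H ∈ S, 0 ≤ inp H X}
      = {X : Matrix V V ℝ | Xᵀ = X} ∩ ⋂ H ∈ S, {X | 0 ≤ inp H X} := by
    ext X
    simp [symSet, Matrix.IsSymm]
  rw [this]
  refine (isClosed_eq (by fun_prop) continuous_id).inter (isClosed_biInter fun H _ => ?_)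
  exact isClosed_le continuous_const (continuous_inp_right H)

theorem IsPolyhedralCone.add_mem (hA : IsPolyhedralCone A) {X Y : Matrix V V ℝ} (hX : X ∈ A)
    (hY : Y ∈ A) : X + Y ∈ A := by
  obtain ⟨S, -, -, rfl⟩ := hA
  exact ⟨Matrix.IsSymm.add hX.1 hY.1, fun H hH => by
    rw [inp_add_right]; exact add_nonneg (hX.2 H hH) (hY.2 H hH)⟩

theorem IsPolyhedralCone.smul_mem (hA : IsPolyhedralCone A) {c : ℝ} (hc : 0 ≤ c)
    {X : Matrix V V ℝ} (hX : X ∈ A) : c • X ∈ A := by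
  obtain ⟨S, -, -, rfl⟩ := hA
  exact ⟨Matrix.IsSymm.smul hX.1 c, fun H hH => by
    rw [inp_smul_right]; exact mul_nonneg hc (hX.2 H hH)⟩

theorem IsPolyhedralCone.mem_of_forall_dualCone (hA : IsPolyhedralCone A) {X : Matrix V V ℝ}
    (hX : X ∈ symSet V) (h : ∀ Y ∈ dualCone A, 0 ≤ inp Y X) : X ∈ A := by
  obtain ⟨S, -, hS, rfl⟩ := hA
  exact ⟨hX, fun H hH => h H ⟨hS hH, fun Z hZ => by rw [inp_comm]; exact hZ.2 H hH⟩⟩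

end PolyhedralCone

/-! ### The standing hypotheses and approximate decomposition in `K* + A*`. -/

section Pair

variable {V : Type*} [Fintype V] [DecidableEq V]

/-- A diagonally scaling-invariant polyhedral cone `A` containing the diagonal matrices, together
with a diagonally scaling-invariant closed convex cone `K` of positive semidefinite matrices
containing the nonnegative diagonal matrices. -/
structure IsThetaPair (A K : Set (Matrix V V ℝ)) : Prop where
  polyhedral : IsPolyhedralCone A
  scaling_left : DiagScalingInvariant A
  diagonal_left : Set.range (diagonal : (V → ℝ) → Matrix V V ℝ) ⊆ A
  subset_psdCone : K ⊆ psdCone V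
  scaling_right : DiagScalingInvariant K
  isClosed : IsClosed K
  convex : Convex ℝ K
  diagonal_right : ∀ d : V → ℝ, 0 ≤ d → diagonal d ∈ K

variable {A K : Set (Matrix V V ℝ)}

namespace IsThetaPair

theorem zero_mem_right (h : IsThetaPair A K) : (0 : Matrix V V ℝ) ∈ K := by
  simpa using h.diagonal_right 0 le_rfl

theorem add_mem_right (h : IsThetaPair A K) {X Y : Matrix V V ℝ} (hX : X ∈ K) (hY : Y ∈ K) :
    X + Y ∈ K := by
  have := h.scaling_right.smul_mem (c := 2) zero_le_two
    (h.convex hX hY (a := 1 / 2) (b := 1 / 2) (by norm_num) (by norm_num) (by norm_num))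
  simpa [smul_smul] using this

theorem convex_left (h : IsThetaPair A K) : Convex ℝ A := fun _ hX _ hY _ _ ha hb _ =>
  h.polyhedral.add_mem (h.polyhedral.smul_mem ha hX) (h.polyhedral.smul_mem hb hY)

theorem mem_right_of_forall_dualCone (h : IsThetaPair A K) {X : Matrix V V ℝ}
    (hX : X ∈ symSet V) (hd : ∀ Y ∈ dualCone K, 0 ≤ inp Y X) : X ∈ K := by
  by_contra hXK
  obtain ⟨Y, hY, hneg⟩ := exists_mem_dualCone_inp_neg
    (fun Z hZ => isSymm_of_posSemidef (h.subset_psdCone hZ)) h.isClosed h.convex h.zero_mem_right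
    (fun c hc Z hZ => h.scaling_right.smul_mem hc hZ) hX hXK
  exact (hd Y hY).not_gt (inp_comm X Y ▸ hneg)

/-- The identity is interior to the dual of `K ∩ A`: a positive multiple of it may be
added to reach the sum of the dual cones. -/
theorem exists_add_smul_one (h : IsThetaPair A K) {M : Matrix V V ℝ} (hM : M ∈ symSet V)
    (hd : ∀ X ∈ K ∩ A, 0 ≤ inp X M) {ε : ℝ} (hε : 0 < ε) :
    ∃ Y ∈ dualCone A, M + ε • (1 : Matrix V V ℝ) - Y ∈ dualCone K := by
  have hcl : M ∈ closure (dualCone K + dualCone A) := by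
    by_contra hMc
    have hsub : closure (dualCone K + dualCone A) ⊆ symSet V := by
      refine closure_minimal ?_ (isClosed_eq (f := fun X : Matrix V V ℝ => Xᵀ)
        (by fun_prop) continuous_id)
      rintro _ ⟨Y, hY, Z, hZ, rfl⟩
      exact Matrix.IsSymm.add hY.1 hZ.1
    have hzero : (0 : Matrix V V ℝ) ∈ closure (dualCone K + dualCone A) :=
      subset_closure ⟨0, zero_mem_dualCone, 0, zero_mem_dualCone, add_zero 0⟩
    have hcv : ∀ C : Set (Matrix V V ℝ), Convex ℝ (dualCone C) := fun C _ hX _ hY _ _ ha hb _ =>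
      dualCone_add (dualCone_smul ha hX) (dualCone_smul hb hY)
    obtain ⟨Z, hZ, hneg⟩ := exists_mem_dualCone_inp_neg hsub isClosed_closure
      ((hcv K).add (hcv A)).closure hzero (fun c hc X hX => by
        refine map_mem_closure (continuous_const_smul c) hX ?_
        rintro _ ⟨Y, hY, Z, hZ, rfl⟩
        exact ⟨c • Y, dualCone_smul hc hY, c • Z, dualCone_smul hc hZ, (smul_add c Y Z).symm⟩)
      hM hMc
    have hZK : Z ∈ K := h.mem_right_of_forall_dualCone hZ.1 fun Y hY =>
      hZ.2 Y (subset_closure ⟨Y, hY, 0, zero_mem_dualCone, add_zero Y⟩)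
    have hZA : Z ∈ A := h.polyhedral.mem_of_forall_dualCone hZ.1 fun Y hY =>
      hZ.2 Y (subset_closure ⟨0, zero_mem_dualCone, Y, hY, zero_add Y⟩)
    exact (hd Z ⟨hZK, hZA⟩).not_gt (inp_comm M Z ▸ hneg)
  -- An entrywise error `δ` costs a shift of `card V * δ`; the `+ 1` keeps the denominator positive
  -- also for empty `V`.
  have hδ : 0 < ε / (Fintype.card V + 1) := by positivity
  have hnear : ∀ᶠ N in nhds M, ∀ i j, |(M - N) i j| < ε / (Fintype.card V + 1) := by
    refine Filter.eventually_all.2 fun i => Filter.eventually_all.2 fun j => ?_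
    have hc : Continuous fun N : Matrix V V ℝ => |(M - N) i j| := by
      simp only [Matrix.sub_apply]
      fun_prop
    exact hc.continuousAt.eventually_lt continuousAt_const (by simpa using hδ)
  obtain ⟨_, ⟨Z, hZ, Y, hY, rfl⟩, hN⟩ := ((mem_closure_iff_frequently.1 hcl).and_eventually
    hnear).exists
  refine ⟨Y, hY, ?_⟩
  have hpsd := posSemidef_add_smul_one (ε := ε)
    (Matrix.IsSymm.sub hM (Matrix.IsSymm.add hZ.1 hY.1)) (fun i j => (hN i j).le) (by
      rw [mul_div_assoc', div_le_iff₀ (by positivity)]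
      nlinarith)
  have := dualCone_add hZ (psdCone_subset_dualCone h.subset_psdCone hpsd)
  convert this using 1
  abel

end IsThetaPair

end Pair

/-! ### Bordered matrices and Schur complements. -/

section Border

variable {V : Type*}

/-- The matrix `[1, xᵀ; x, X]`. -/
def border (x : V → ℝ) (X : Matrix V V ℝ) : Matrix (Option V) (Option V) ℝ :=
  Matrix.of fun i j => i.elim (j.elim 1 x) fun a => j.elim (x a) (X a)

@[simp]
theorem border_none_none (x : V → ℝ) (X : Matrix V V ℝ) : border x X none none = 1 := rfl

@[simp]
theorem border_none_some (x : V → ℝ) (X : Matrix V V ℝ) (j : V) :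
    border x X none (some j) = x j := rfl

@[simp]
theorem border_some_none (x : V → ℝ) (X : Matrix V V ℝ) (i : V) :
    border x X (some i) none = x i := rfl

@[simp]
theorem border_some_some (x : V → ℝ) (X : Matrix V V ℝ) (i j : V) :
    border x X (some i) (some j) = X i j := rfl

@[simp]
theorem corner_border (x : V → ℝ) (X : Matrix V V ℝ) : corner (border x X) = X := rfl

theorem isSymm_border {x : V → ℝ} {X : Matrix V V ℝ} (hX : X.IsSymm) : (border x X).IsSymm := by
  ext (_ | i) (_ | j) <;> simp [hX.apply]

/-- The normalisation and the condition on column `0` determine the border, so only the corner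
remains free. -/
theorem mem_genTH_iff {A : Set (Matrix V V ℝ)} {C : Set (Matrix (Option V) (Option V) ℝ)}
    (hC : C ⊆ symSet (Option V)) {x : V → ℝ} :
    x ∈ genTH A C ↔ ∃ X ∈ A, X.diag = x ∧ border x X ∈ C := by
  constructor
  · rintro ⟨Z, ⟨hZC, h1, hcol, hA⟩, rfl⟩
    refine ⟨corner Z, hA, rfl, ?_⟩
    convert hZC
    have hs : Z.IsSymm := hC hZC
    have hc : ∀ i, Z i none = Z i i := fun i => congrFun hcol i
    ext (_ | i) (_ | j)
    · simp [h1]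
    · simp [corner, ← hc, hs.apply]
    · simp [corner, ← hc]
    · rfl
  · rintro ⟨X, hA, rfl, hX⟩
    refine ⟨border X.diag X, ⟨hX, rfl, ?_, hA⟩, rfl⟩
    ext (_ | i) <;> rfl

theorem mem_genTH_schurLift_iff {A C : Set (Matrix V V ℝ)} (hC : C ⊆ symSet V) {x : V → ℝ} :
    x ∈ genTH A (schurLift C) ↔
      ∃ X ∈ A, X.diag = x ∧ X ∈ C ∧ X - vecMulVec x x ∈ C := by
  rw [mem_genTH_iff fun X hX => hX.1]
  refine exists_congr fun X => and_congr_right fun _ => and_congr_right fun _ => ?_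
  constructor
  · rintro ⟨-, h1, -, h2⟩
    simp only [corner_border, border_none_none, one_smul, border_some_none] at h1 h2
    exact ⟨h1, h2⟩
  · rintro ⟨h1, h2⟩
    refine ⟨isSymm_border (hC h1), h1, by simp, ?_⟩
    simpa only [corner_border, border_none_none, one_smul, border_some_none] using h2

theorem psdLift_psdCone : psdLift (psdCone V) = psdCone (Option V) :=
  Set.ext fun _ => ⟨fun h => h.1, fun h => ⟨h, Matrix.PosSemidef.submatrix h some⟩⟩

variable [Fintype V]

theorem posSemidef_border_iff {x : V → ℝ} {X : Matrix V V ℝ} :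
    (border x X).PosSemidef ↔ (X - vecMulVec x x).PosSemidef := by
  have hquad : ∀ v : Option V → ℝ, v ⬝ᵥ border x X *ᵥ v
      = (v none + x ⬝ᵥ (v ∘ some)) ^ 2 + (v ∘ some) ⬝ᵥ (X - vecMulVec x x) *ᵥ (v ∘ some) := by
    intro v
    have h1 : v ⬝ᵥ border x X *ᵥ v = v none * (v none + x ⬝ᵥ (v ∘ some))
        + ((v ∘ some) ⬝ᵥ x * v none + (v ∘ some) ⬝ᵥ X *ᵥ (v ∘ some)) := by
      simp [dotProduct, mulVec, Fintype.sum_option, mul_add, Finset.sum_add_distrib,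
        Finset.sum_mul, mul_assoc]
      ring
    rw [h1, sub_mulVec, dotProduct_sub, vecMulVec_mulVec, op_smul_eq_smul, dotProduct_smul,
      smul_eq_mul, dotProduct_comm (v ∘ some) x]
    ring
  rw [posSemidef_iff_isSymm, posSemidef_iff_isSymm]
  constructor
  · rintro ⟨hs, hn⟩
    have hX : X.IsSymm := hs.submatrix some
    refine ⟨hX.sub (isSymm_vecMulVec_self x), fun u => ?_⟩
    -- This choice of the coordinate at `none` makes the completed square vanish, leaving the form
    -- of the Schur complement.
    have := hn fun i => i.elim (-(x ⬝ᵥ u)) u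
    rw [hquad] at this
    simpa [Function.comp_def] using this
  · rintro ⟨hs, hn⟩
    have hX : X.IsSymm := by simpa using hs.add (isSymm_vecMulVec_self x)
    refine ⟨isSymm_border hX, fun v => ?_⟩
    rw [hquad]
    exact add_nonneg (sq_nonneg _) (hn _)

theorem mem_genTH_psdCone_iff {A : Set (Matrix V V ℝ)} {x : V → ℝ} :
    x ∈ genTH A (psdCone (Option V)) ↔ ∃ X ∈ A, X.diag = x ∧ (X - vecMulVec x x).PosSemidef := by
  rw [mem_genTH_iff psdCone_subset_symSet]
  exact exists_congr fun X => and_congr_right fun _ => and_congr_right fun _ =>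
    posSemidef_border_iff

theorem mem_genTH_psdLift_iff {A K : Set (Matrix V V ℝ)} {x : V → ℝ} :
    x ∈ genTH A (psdLift K) ↔
      ∃ X ∈ A, X.diag = x ∧ (X - vecMulVec x x).PosSemidef ∧ X ∈ K := by
  rw [mem_genTH_iff fun X hX => isSymm_of_posSemidef hX.1]
  exact exists_congr fun X => and_congr_right fun _ => and_congr_right fun _ =>
    and_congr_left fun _ => posSemidef_border_iff

/-- The extra requirement `X ∈ S₊` of the Schur lifting follows by adding `x xᵀ` to `X - x xᵀ`. -/
theorem genTH_schurLift_psdCone (A : Set (Matrix V V ℝ)) :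
    genTH A (schurLift (psdCone V)) = genTH A (psdCone (Option V)) := by
  ext x
  rw [mem_genTH_psdCone_iff, mem_genTH_schurLift_iff psdCone_subset_symSet]
  refine exists_congr fun X => and_congr_right fun _ => and_congr_right fun _ => ?_
  refine ⟨fun h => h.2, fun h => ⟨?_, h⟩⟩
  have : (X - vecMulVec x x + vecMulVec x x).PosSemidef := h.add (posSemidef_vecMulVec x)
  rw [sub_add_cancel] at this
  exact this

end Border

/-! ### The dual body and its rescaling to `theta2`. -/

namespace IsThetaPair

variable {V : Type*} [Fintype V] [DecidableEq V] {A K : Set (Matrix V V ℝ)}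

/-- Members of `A*` have zero diagonal, which forces the diagonal part to be `Diag(x)`. The
condition `X ∈ K*` is redundant because `x xᵀ ∈ S₊ ⊆ K*`. -/
theorem mem_dualBody_iff (h : IsThetaPair A K) {x : V → ℝ} :
    x ∈ dualBody A K ↔
      ∃ N ∈ dualCone A, diagonal x - N - vecMulVec x x ∈ dualCone K := by
  rw [dualBody, mem_genTH_schurLift_iff fun X hX => hX.1]
  constructor
  · rintro ⟨X, ⟨_, ⟨d, rfl⟩, N, hN, rfl⟩, hx, -, hX⟩
    have hd : d = x := by
      have hN0 := diag_eq_zero_of_mem_dualCone h.diagonal_left hN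
      rw [← hx]
      change d = (diagonal d - N).diag
      rw [diag_sub, hN0, diag_diagonal, sub_zero]
    exact ⟨N, hN, hd ▸ hX⟩
  · rintro ⟨N, hN, hX⟩
    refine ⟨diagonal x - N, ⟨diagonal x, ⟨x, rfl⟩, N, hN, rfl⟩, ?_, ?_, hX⟩
    · rw [diag_sub, diag_eq_zero_of_mem_dualCone h.diagonal_left hN, diag_diagonal, sub_zero]
    · simpa using dualCone_add hX
        (psdCone_subset_dualCone h.subset_psdCone (posSemidef_vecMulVec x))

theorem nonneg_of_mem_dualBody (h : IsThetaPair A K) {x : V → ℝ} (hx : x ∈ dualBody A K) :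
    0 ≤ x := fun i => by
  obtain ⟨N, hN, hM⟩ := h.mem_dualBody_iff.1 hx
  have h1 := diag_nonneg_of_mem_dualCone h.diagonal_right hM i
  have h2 : N i i = 0 := congrFun (diag_eq_zero_of_mem_dualCone h.diagonal_left hN) i
  simp only [Matrix.sub_apply, diagonal_apply_eq, h2, vecMulVec_apply] at h1
  -- The diagonal entry of the certificate is `x i - x i ^ 2`.
  have : 0 ≤ x i := by nlinarith [mul_self_nonneg (x i)]
  exact this

theorem mem_theta2Feasible_iff (h : IsThetaPair A K) {w : V → ℝ} {p : ℝ × Matrix V V ℝ} :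
    p ∈ theta2Feasible A K w ↔ p.2 ∈ dualCone A ∧
      p.1 • (1 : Matrix V V ℝ) - p.2 - vecMulVec (sqrtVec w) (sqrtVec w) ∈ dualCone K := by
  rw [sub_sub]
  constructor
  · rintro ⟨h1, ⟨_, ⟨d, rfl⟩, N, hN, hY⟩, hd⟩
    change diagonal d - N = -p.2 at hY
    have hd0 : d = 0 := by
      have := congrArg diag hY
      rwa [diag_sub, diag_diagonal, diag_eq_zero_of_mem_dualCone h.diagonal_left hN, diag_neg, hd,
        sub_zero, neg_zero] at this
    have hp : p.2 = N := by simpa [hd0] using hY.symm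
    exact ⟨hp ▸ hN, h1⟩
  · rintro ⟨h1, h2⟩
    refine ⟨h2, ⟨0, ⟨0, diagonal_zero⟩, p.2, h1, zero_sub _⟩, ?_⟩
    exact diag_eq_zero_of_mem_dualCone h.diagonal_left h1

theorem le_of_mem_theta2Feasible (h : IsThetaPair A K) {w : V → ℝ} (hw : 0 ≤ w)
    {p : ℝ × Matrix V V ℝ} (hp : p ∈ theta2Feasible A K w) (i : V) : w i ≤ p.1 := by
  rw [h.mem_theta2Feasible_iff] at hp
  have h1 := diag_nonneg_of_mem_dualCone h.diagonal_right hp.2 i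
  have h2 : p.2 i i = 0 := congrFun (diag_eq_zero_of_mem_dualCone h.diagonal_left hp.1) i
  simpa [h2, vecMulVec_apply, sqrtVec, Real.mul_self_sqrt (hw i)] using h1

/-- A feasible value of the dual problem gives a point of the dual body. -/
theorem inv_smul_mem_dualBody (h : IsThetaPair A K) {w : V → ℝ} (hw : 0 ≤ w)
    {p : ℝ × Matrix V V ℝ} (hp : p ∈ theta2Feasible A K w) (hpos : 0 < p.1) :
    p.1⁻¹ • w ∈ dualBody A K := by
  obtain ⟨hY, hM⟩ := h.mem_theta2Feasible_iff.1 hp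
  rw [h.mem_dualBody_iff]
  have hs : (0 : V → ℝ) ≤ fun i => p.1⁻¹ * sqrtVec w i := fun i =>
    mul_nonneg (inv_nonneg.2 hpos.le) (Real.sqrt_nonneg _)
  refine ⟨_, h.scaling_left.dualCone _ hs _ hY, ?_⟩
  have := h.scaling_right.dualCone _ hs _ hM
  convert this using 1
  ext i j
  have hi : √(w i) * √(w i) = w i := Real.mul_self_sqrt (hw i)
  have hj : √(w j) * √(w j) = w j := Real.mul_self_sqrt (hw j)
  simp only [Matrix.sub_apply, diagonal_mul_mul_diagonal_apply, vecMulVec_apply, Pi.smul_apply,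
    smul_eq_mul, Matrix.smul_apply, sqrtVec, diagonal_apply, one_apply]
  split_ifs with hij
  · subst hij
    generalize √(w i) = a at hi
    rw [← hi]
    field_simp
  · generalize √(w i) = a at hi
    generalize √(w j) = b at hj
    rw [← hi, ← hj]
    ring

/-- A point of the dual body dominating `w / lam` gives feasibility of `lam`. -/
theorem exists_mem_theta2Feasible (h : IsThetaPair A K) {w x : V → ℝ} (hw : 0 ≤ w)
    (hx : x ∈ dualBody A K) {lam : ℝ} (hlam : ∀ i, w i ≤ lam * x i) (hpos : 0 ≤ lam) :
    ∃ Y, (lam, Y) ∈ theta2Feasible A K w := by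
  obtain ⟨N, hN, hM⟩ := h.mem_dualBody_iff.1 hx
  have hx0 : ∀ i, 0 ≤ x i := h.nonneg_of_mem_dualBody hx
  set t : V → ℝ := fun i => sqrtVec w i / x i with ht
  have ht0 : 0 ≤ t := fun i => div_nonneg (Real.sqrt_nonneg _) (hx0 i)
  -- Where `x i = 0`, domination forces `w i = 0`, so the value `t i = 0` from division by zero is
  -- the right one.
  have htx : ∀ i, t i * x i = sqrtVec w i := fun i => by
    rcases eq_or_ne (x i) 0 with h0 | h0
    · have : w i = 0 := le_antisymm (by simpa [h0] using hlam i) (hw i)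
      simp [h0, sqrtVec, this]
    · exact div_mul_cancel₀ _ h0
  have htw : ∀ i, t i * x i * t i ≤ lam := fun i => by
    rcases eq_or_ne (x i) 0 with h0 | h0
    · simpa [h0] using hpos
    · have hpx : 0 < x i := lt_of_le_of_ne (hx0 i) h0.symm
      have : t i * x i * t i = w i / x i := by
        rw [htx]
        simp only [ht, sqrtVec, ← mul_div_assoc]
        rw [Real.mul_self_sqrt (hw i)]
      rw [this, div_le_iff₀ hpx]
      exact hlam i
  refine ⟨diagonal t * N * diagonal t, h.mem_theta2Feasible_iff.2
    ⟨h.scaling_left.dualCone t ht0 N hN, ?_⟩⟩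
  have h1 := h.scaling_right.dualCone t ht0 _ hM
  -- Scaling leaves `t i * x i * t i ≤ lam` on the diagonal; this nonnegative diagonal matrix makes
  -- up the slack to `lam • 1`.
  have h2 : diagonal (fun i => lam - t i * x i * t i) ∈ dualCone K :=
    psdCone_subset_dualCone h.subset_psdCone
      (Matrix.PosSemidef.diagonal fun i => sub_nonneg.2 (htw i))
  convert dualCone_add h1 h2 using 1
  ext i j
  simp only [Matrix.sub_apply, Matrix.add_apply, diagonal_mul_mul_diagonal_apply, vecMulVec_apply,
    Matrix.smul_apply, smul_eq_mul, ← htx, diagonal_apply, one_apply]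
  split_ifs with hij
  · subst hij
    ring
  · ring

end IsThetaPair

namespace IsThetaPair

variable {V : Type*} [Fintype V] [DecidableEq V] {A K : Set (Matrix V V ℝ)}

/-! ### Conic duality between `theta2` and `theta3`. -/

section Duality

variable {w : V → ℝ}

theorem quad_le_of_mem_theta2Feasible (h : IsThetaPair A K) {p : ℝ × Matrix V V ℝ}
    (hp : p ∈ theta2Feasible A K w) {X : Matrix V V ℝ} (hX : X ∈ theta3Feasible A K) :
    sqrtVec w ⬝ᵥ X *ᵥ sqrtVec w ≤ p.1 := by
  obtain ⟨hY, hM⟩ := h.mem_theta2Feasible_iff.1 hp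
  obtain ⟨htr, hK, hA⟩ := hX
  have h1 := hM.2 X hK
  have h2 := hY.2 X hA
  rw [inp_sub_right, inp_sub_right, inp_smul_right, inp_one, htr, inp_vecMulVec] at h1
  linarith

/-- Normalising by the trace turns the bound into nonnegativity of `lam • 1 - √w √wᵀ` on all of `K ∩
A`; a matrix of trace zero in `K` is zero. -/
theorem exists_mem_theta2Feasible_add (h : IsThetaPair A K) {lam : ℝ}
    (hlam : ∀ X ∈ theta3Feasible A K, sqrtVec w ⬝ᵥ X *ᵥ sqrtVec w ≤ lam) {ε : ℝ} (hε : 0 < ε) :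
    ∃ Y, (lam + ε, Y) ∈ theta2Feasible A K w := by
  obtain ⟨Y, hY, hM⟩ := h.exists_add_smul_one
    (M := lam • (1 : Matrix V V ℝ) - vecMulVec (sqrtVec w) (sqrtVec w))
    ((isSymm_one.smul lam).sub (isSymm_vecMulVec_self _)) (fun X ⟨hK, hA⟩ => by
      rw [inp_sub_right, inp_smul_right, inp_one, inp_vecMulVec]
      have hpsd : X.PosSemidef := h.subset_psdCone hK
      rcases hpsd.trace_nonneg.eq_or_lt with h0 | h0
      · rw [hpsd.trace_eq_zero_iff.1 h0.symm]
        simp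
      · have h1 := hlam (X.trace⁻¹ • X) ⟨by simp [trace_smul, h0.ne'],
          h.scaling_right.smul_mem (inv_nonneg.2 h0.le) hK,
          h.polyhedral.smul_mem (inv_nonneg.2 h0.le) hA⟩
        rw [smul_mulVec, dotProduct_smul, smul_eq_mul, inv_mul_le_iff₀ h0] at h1
        linarith) hε
  refine ⟨Y, h.mem_theta2Feasible_iff.2 ⟨hY, ?_⟩⟩
  convert hM using 1
  simp only [add_smul]
  abel

theorem isCompact_theta3Feasible (h : IsThetaPair A K) : IsCompact (theta3Feasible A K) := by
  refine isCompact_posSemidef_of_diag_le _ ?_ (fun X hX => h.subset_psdCone hX.2.1) ?_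
  · exact (isClosed_eq (f := fun X : Matrix V V ℝ => X.trace) (by fun_prop)
      continuous_const).inter (h.isClosed.inter h.polyhedral.isClosed)
  · rintro X ⟨htr, hK, -⟩ i
    rw [← htr]
    exact Finset.single_le_sum (f := fun i => X i i)
      (fun j _ => (h.subset_psdCone hK).diag_nonneg) (Finset.mem_univ i)

theorem nonempty_theta3Feasible [Nonempty V] (h : IsThetaPair A K) :
    (theta3Feasible A K).Nonempty := by
  obtain ⟨i⟩ := ‹Nonempty V›
  exact ⟨diagonal (Pi.single i 1), by simp [trace_diagonal],
    h.diagonal_right _ (Pi.single_nonneg.2 zero_le_one), h.diagonal_left ⟨_, rfl⟩⟩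

theorem exists_max_theta3Feasible [Nonempty V] (h : IsThetaPair A K) (w : V → ℝ) :
    ∃ X ∈ theta3Feasible A K, ∀ Z ∈ theta3Feasible A K,
      sqrtVec w ⬝ᵥ Z *ᵥ sqrtVec w ≤ sqrtVec w ⬝ᵥ X *ᵥ sqrtVec w :=
  h.isCompact_theta3Feasible.exists_isMaxOn h.nonempty_theta3Feasible
    (f := fun X => sqrtVec w ⬝ᵥ X *ᵥ sqrtVec w) (by fun_prop)

end Duality

/-! ### The theta body: convexity, compactness, monotonicity, and its link to `theta3`. -/

section Body

variable {w : V → ℝ}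

theorem nonneg_of_mem_genTH (h : IsThetaPair A K) {x : V → ℝ} (hx : x ∈ genTH A (psdLift K)) :
    0 ≤ x := by
  obtain ⟨X, -, rfl, -, hK⟩ := mem_genTH_psdLift_iff.1 hx
  exact fun i => (h.subset_psdCone hK).diag_nonneg

theorem convex_genTH (h : IsThetaPair A K) : Convex ℝ (genTH A (psdLift K)) := by
  have hlift : Convex ℝ (liftedTH A (psdLift K)) := by
    rintro X ⟨⟨hX1, hX2⟩, hX3, hX4, hX5⟩ Y ⟨⟨hY1, hY2⟩, hY3, hY4, hY5⟩ a b ha hb hab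
    refine ⟨⟨convex_psdCone hX1 hY1 ha hb hab, h.convex hX2 hY2 ha hb hab⟩, ?_, ?_,
      h.convex_left hX5 hY5 ha hb hab⟩
    · simp [hX3, hY3, hab]
    · ext i
      have h1 := congrFun hX4 i
      have h2 := congrFun hY4 i
      simp only [col_apply, diag_apply] at h1 h2
      simp [h1, h2]
  exact hlift.is_linear_image (f := fun X => (corner X).diag)
    ⟨fun X Y => rfl, fun c X => rfl⟩

theorem isCompact_genTH (h : IsThetaPair A K) : IsCompact (genTH A (psdLift K)) := by
  have hcorner : Continuous (corner : Matrix (Option V) (Option V) ℝ → Matrix V V ℝ) := by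
    unfold corner
    fun_prop
  have hlift : IsCompact (liftedTH A (psdLift K)) := by
    refine isCompact_posSemidef_of_diag_le _ ?_ (fun X hX => hX.1.1) ?_
    · refine (isClosed_psdCone.inter (h.isClosed.preimage hcorner)).inter
        ((isClosed_eq (f := fun X : Matrix (Option V) (Option V) ℝ => X none none)
          (by fun_prop) continuous_const).inter
        (IsClosed.inter (isClosed_eq (f := fun X : Matrix (Option V) (Option V) ℝ => X.col none)
          (g := Matrix.diag) ?_ (by fun_prop)) (h.polyhedral.isClosed.preimage hcorner)))
      exact continuous_pi fun i => by simp only [col_apply]; fun_prop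
    · rintro X ⟨⟨hX, -⟩, h1, hcol, -⟩ i
      -- With `X i none = X i i` and `X none none = 1` this reads `X i i ^ 2 ≤ X i i`, hence `X i i
      -- ≤ 1`.
      have h2 := sq_le_diag_mul_diag hX i none
      have h3 : X i none = X i i := congrFun hcol i
      have h4 : 0 ≤ X i i := Matrix.PosSemidef.diag_nonneg hX
      rw [h3, h1, mul_one] at h2
      nlinarith
  exact hlift.image (by fun_prop)

/-- Scaling by `t` produces the diagonal `t² x`; adding the nonnegative diagonal `(t - t²) x`
corrects it to `t x`. -/
theorem mul_mem_genTH (h : IsThetaPair A K) {x t : V → ℝ} (hx : x ∈ genTH A (psdLift K))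
    (ht0 : 0 ≤ t) (ht1 : t ≤ 1) : t * x ∈ genTH A (psdLift K) := by
  obtain ⟨X, hA, rfl, hX, hK⟩ := mem_genTH_psdLift_iff.1 hx
  have hd : (0 : V → ℝ) ≤ fun i => (t i - t i * t i) * X i i := fun i =>
    mul_nonneg (sub_nonneg.2 (mul_le_of_le_one_left (ht0 i) (ht1 i)))
      (h.subset_psdCone hK).diag_nonneg
  refine mem_genTH_psdLift_iff.2
    ⟨diagonal t * X * diagonal t + diagonal fun i => (t i - t i * t i) * X i i,
      h.polyhedral.add_mem (h.scaling_left t ht0 X hA) (h.diagonal_left ⟨_, rfl⟩), ?_, ?_,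
      h.add_mem_right (h.scaling_right t ht0 X hK) (h.diagonal_right _ hd)⟩
  · ext i
    simp only [diag_apply, Matrix.add_apply, diagonal_mul_mul_diagonal_apply, diagonal_apply_eq,
      Pi.mul_apply]
    ring
  · convert (posSemidef_diagonal_conj hX t).add (Matrix.PosSemidef.diagonal hd) using 1
    ext i j
    simp only [Matrix.sub_apply, Matrix.add_apply, diagonal_mul_mul_diagonal_apply,
      vecMulVec_apply, Pi.mul_apply, diag_apply]
    ring

theorem zero_mem_genTH (h : IsThetaPair A K) : (0 : V → ℝ) ∈ genTH A (psdLift K) := by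
  refine mem_genTH_psdLift_iff.2 ⟨0, ?_, rfl, ?_, h.zero_mem_right⟩
  · exact h.diagonal_left ⟨0, diagonal_zero⟩
  · simpa using Matrix.PosSemidef.zero

/-- With `s = √w`, `p = X s` and `q = sᵀ X s`, the downdate `X - p pᵀ / q` is positive semidefinite.
The scaling `t` is chosen so that the scaled matrix has diagonal `t p / √q`, which is exactly the
scaled vector `p / √q`; the truncation `max (p i) 0` keeps `t` nonnegative. -/
theorem exists_mem_genTH_quad_le (h : IsThetaPair A K) (hw : 0 ≤ w) {X : Matrix V V ℝ}
    (hX : X ∈ theta3Feasible A K) :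
    ∃ x ∈ genTH A (psdLift K), sqrtVec w ⬝ᵥ X *ᵥ sqrtVec w ≤ w ⬝ᵥ x := by
  obtain ⟨htr, hK, hA⟩ := hX
  have hpsd : X.PosSemidef := h.subset_psdCone hK
  set s := sqrtVec w with hs
  set p := X *ᵥ s with hp
  set q := s ⬝ᵥ p with hq
  have hq0 : 0 ≤ q := (posSemidef_iff_isSymm.1 hpsd).2 s
  rcases hq0.eq_or_lt with h0 | hqpos
  · exact ⟨0, h.zero_mem_genTH, by rw [← h0, dotProduct_zero]⟩
  have hXi : ∀ i, 0 ≤ X i i := fun i => hpsd.diag_nonneg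
  -- A zero diagonal entry kills the whole row of `X`, so the quotients by `X i i = 0` below lose
  -- nothing.
  have hp0 : ∀ i, X i i = 0 → p i = 0 := fun i hi => by
    have := sq_dotProduct_mulVec_le hpsd (Pi.single i 1) s
    simp only [mulVec_single_one, single_one_dotProduct, col_apply, hi, zero_mul] at this
    exact pow_eq_zero_iff two_ne_zero |>.1 (le_antisymm this (sq_nonneg _))
  set t : V → ℝ := fun i => max (p i) 0 / (√q * X i i) with ht
  have ht0 : 0 ≤ t := fun i =>
    div_nonneg (le_max_right _ _) (mul_nonneg (Real.sqrt_nonneg _) (hXi i))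
  have hsq : 0 < √q := Real.sqrt_pos.2 hqpos
  have htt : ∀ i, t i * X i i * t i = t i * (p i / √q) := fun i => by
    rcases (hXi i).eq_or_lt with h1 | h1
    · simp [ht, ← h1]
    rcases le_total (p i) 0 with h2 | h2
    · simp [ht, max_eq_right h2]
    · simp only [ht, max_eq_left h2]
      field_simp
  refine ⟨(diagonal t * X * diagonal t).diag, mem_genTH_psdLift_iff.2 ⟨_,
    h.scaling_left t ht0 X hA, rfl, ?_, h.scaling_right t ht0 X hK⟩, ?_⟩
  · convert posSemidef_diagonal_conj (posSemidef_sub_vecMulVec_mulVec hpsd s) t using 1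
    ext i j
    have hqq : q⁻¹ = (√q)⁻¹ * (√q)⁻¹ := by rw [← mul_inv, Real.mul_self_sqrt hq0]
    simp only [Matrix.sub_apply, diagonal_mul_mul_diagonal_apply, vecMulVec_apply, diag_apply,
      Matrix.smul_apply, smul_eq_mul, htt]
    rw [← hp, ← hq, hqq]
    ring
  · set y : V → ℝ := fun i => max (p i) 0 with hy
    have hle : q ≤ ∑ i, s i * y i :=
      Finset.sum_le_sum fun i _ => mul_le_mul_of_nonneg_left (le_max_left _ _)
        (Real.sqrt_nonneg _)
    have hval : w ⬝ᵥ (diagonal t * X * diagonal t).diag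
        = q⁻¹ * ∑ i, w i * (y i ^ 2 / X i i) := by
      simp only [dotProduct, Finset.mul_sum, diag_apply, diagonal_mul_mul_diagonal_apply]
      refine Finset.sum_congr rfl fun i _ => ?_
      rcases (hXi i).eq_or_lt with h1 | h1
      · simp [← h1]
      · have hqq : q = √q * √q := (Real.mul_self_sqrt hq0).symm
        simp only [ht, hy]
        rw [hqq, Real.sqrt_mul_self hsq.le]
        field_simp
    -- Cauchy–Schwarz against the weights `X i i`, whose sum is `1`; with `q ≤ ∑ s i * y i` it
    -- bounds the objective below by `q² / q`.
    have hcs : (∑ i, s i * y i) ^ 2 ≤ (∑ i, w i * (y i ^ 2 / X i i)) * ∑ i, X i i := by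
      refine Finset.sum_sq_le_sum_mul_sum_of_sq_le_mul _
        (fun i _ => mul_nonneg (hw i) (div_nonneg (sq_nonneg _) (hXi i)))
        (fun i _ => hXi i) fun i _ => ?_
      rcases (hXi i).eq_or_lt with h1 | h1
      · simp [hy, hp0 i h1.symm]
      · rw [mul_pow, mul_assoc, div_mul_cancel₀ _ h1.ne']
        simp only [hs, sqrtVec]
        rw [Real.sq_sqrt (hw i)]
    have htr' : ∑ i, X i i = 1 := htr
    rw [htr', mul_one] at hcs
    rw [hval, le_inv_mul_iff₀ hqpos]
    nlinarith

end Body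

end IsThetaPair

/-! ### Antiblockers and the ratio objective. -/

section Antiblocker

theorem extDiv_le_coe_iff {a b M : ℝ} (ha : 0 ≤ a) (hb : 0 ≤ b) (hM : 0 ≤ M) :
    extDiv a b ≤ (M : EReal) ↔ a ≤ M * b := by
  unfold extDiv
  split_ifs with h1 h2
  · simpa [h1, hM] using mul_nonneg hM hb
  · simpa [h2] using lt_of_le_of_ne ha (Ne.symm h1)
  · rw [EReal.coe_le_coe_iff, div_le_iff₀ (lt_of_le_of_ne hb (Ne.symm h2))]

theorem extDiv_nonneg {a b : ℝ} (ha : 0 ≤ a) (hb : 0 ≤ b) : 0 ≤ extDiv a b := by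
  unfold extDiv
  split_ifs
  · exact le_rfl
  · exact le_top
  · exact EReal.coe_nonneg.2 (div_nonneg ha hb)

variable {V : Type*}

theorem maxRatio_le_coe_iff {w x : V → ℝ} (hw : 0 ≤ w) (hx : 0 ≤ x) {M : ℝ} (hM : 0 ≤ M) :
    maxRatio w x ≤ (M : EReal) ↔ ∀ i, w i ≤ M * x i := by
  rw [maxRatio, iSup_le_iff]
  exact forall_congr' fun i => extDiv_le_coe_iff (hw i) (hx i) hM

theorem maxRatio_nonneg [Nonempty V] {w x : V → ℝ} (hw : 0 ≤ w) (hx : 0 ≤ x) :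
    0 ≤ maxRatio w x := by
  obtain ⟨i⟩ := ‹Nonempty V›
  exact (extDiv_nonneg (hw i) (hx i)).trans (le_iSup (fun i => extDiv (w i) (x i)) i)

variable [Fintype V]

theorem abl_closure (C : Set (V → ℝ)) : abl (closure C) = abl C := by
  refine Set.Subset.antisymm (fun y hy => ⟨hy.1, fun x hx => hy.2 x (subset_closure hx)⟩)
    fun y hy => ⟨hy.1, fun x hx => ?_⟩
  exact closure_minimal (t := {x | y ⬝ᵥ x ≤ 1}) hy.2
    (isClosed_le (by fun_prop) continuous_const) hx

/-- The support function of the antiblocker bounds the gauge from below. -/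
theorem dotProduct_le_maxRatio [Nonempty V] {C : Set (V → ℝ)} {w x y : V → ℝ} (hw : 0 ≤ w)
    (hx : 0 ≤ x) (hxC : x ∈ C) (hy : y ∈ abl C) : ((w ⬝ᵥ y : ℝ) : EReal) ≤ maxRatio w x := by
  have h0 := maxRatio_nonneg hw hx
  induction hr : maxRatio w x with
  | bot => simp [hr] at h0
  | top => exact le_top
  | coe M =>
    rw [hr] at h0
    have hM : 0 ≤ M := EReal.coe_nonneg.1 h0
    have hle := (maxRatio_le_coe_iff hw hx hM).1 hr.le
    rw [EReal.coe_le_coe_iff]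
    calc w ⬝ᵥ y ≤ (M • x) ⬝ᵥ y :=
          Finset.sum_le_sum fun i _ => mul_le_mul_of_nonneg_right (hle i) (hy.1 i)
      _ = M * (y ⬝ᵥ x) := by rw [smul_dotProduct, smul_eq_mul, dotProduct_comm]
      _ ≤ M := mul_le_of_le_one_right hM (hy.2 x hxC)

end Antiblocker

/-! ### The antiblocking relation and equality of the parameters. -/

namespace IsThetaPair

variable {V : Type*} [Fintype V] [DecidableEq V] {A K : Set (Matrix V V ℝ)}

theorem nonneg_of_theta3_bound [Nonempty V] (h : IsThetaPair A K) {w : V → ℝ} {lam : ℝ}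
    (hlam : ∀ X ∈ theta3Feasible A K, sqrtVec w ⬝ᵥ X *ᵥ sqrtVec w ≤ lam) : 0 ≤ lam := by
  obtain ⟨X, hX⟩ := h.nonempty_theta3Feasible
  exact ((posSemidef_iff_isSymm.1 (h.subset_psdCone hX.2.1)).2 _).trans (hlam X hX)

theorem inv_smul_add_mem_dualBody [Nonempty V] (h : IsThetaPair A K) {w : V → ℝ} (hw : 0 ≤ w) {lam : ℝ}
    (hlam : ∀ X ∈ theta3Feasible A K, sqrtVec w ⬝ᵥ X *ᵥ sqrtVec w ≤ lam) {ε : ℝ} (hε : 0 < ε) :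
    (lam + ε)⁻¹ • w ∈ dualBody A K := by
  obtain ⟨Y, hY⟩ := h.exists_mem_theta2Feasible_add hlam hε
  exact h.inv_smul_mem_dualBody hw hY (add_pos_of_nonneg_of_pos (h.nonneg_of_theta3_bound hlam) hε)

theorem dotProduct_le_of_mem_abl [Nonempty V] (h : IsThetaPair A K) {w : V → ℝ} (hw : 0 ≤ w) {lam : ℝ}
    (hlam : ∀ X ∈ theta3Feasible A K, sqrtVec w ⬝ᵥ X *ᵥ sqrtVec w ≤ lam) {y : V → ℝ}
    (hy : y ∈ abl (dualBody A K)) : w ⬝ᵥ y ≤ lam := by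
  refine le_of_forall_pos_le_add fun ε hε => ?_
  have h1 := hy.2 _ (h.inv_smul_add_mem_dualBody hw hlam hε)
  rwa [dotProduct_smul, smul_eq_mul, inv_mul_le_iff₀
    (add_pos_of_nonneg_of_pos (h.nonneg_of_theta3_bound hlam) hε), mul_one,
    dotProduct_comm] at h1

/-- Pairing `X` with `Diag(x) - N - x xᵀ` gives `⟨x, y⟩ ≥ xᵀ X x`, and `X - y yᵀ ∈ S₊` gives `xᵀ X x
≥ ⟨x, y⟩²`; hence `⟨x, y⟩ ≤ 1`. -/
theorem genTH_subset_abl (h : IsThetaPair A K) :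
    genTH A (psdLift K) ⊆ abl (dualBody A K) := by
  refine fun y hy => ⟨h.nonneg_of_mem_genTH hy, fun x hx => ?_⟩
  obtain ⟨X, hA, rfl, hX, hK⟩ := mem_genTH_psdLift_iff.1 hy
  obtain ⟨N, hN, hM⟩ := h.mem_dualBody_iff.1 hx
  have h1 := hM.2 X hK
  have h2 := hN.2 X hA
  have h3 := sq_dotProduct_le_of_posSemidef_sub hX x
  rw [inp_sub_right, inp_sub_right, inp_diagonal, inp_vecMulVec] at h1
  rw [dotProduct_comm]
  nlinarith

theorem abl_dualBody [Nonempty V] (h : IsThetaPair A K) : abl (dualBody A K) = genTH A (psdLift K) := by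
  refine Set.Subset.antisymm (fun y hy => ?_) h.genTH_subset_abl
  by_contra hyT
  obtain ⟨f, u, hfT, hfy⟩ :=
    geometric_hahn_banach_closed_point h.convex_genTH h.isCompact_genTH.isClosed hyT
  set v : V → ℝ := fun i => f (Pi.single i 1) with hv
  have hf : ∀ x, f x = v ⬝ᵥ x := fun x => by
    conv_lhs => rw [pi_eq_sum_univ' x]
    simp [hv, dotProduct, map_sum, mul_comm]
  -- The separating functional may have negative coefficients. Its positive part only increases the
  -- value at `y ≥ 0`, and on the theta body that part is attained by zeroing the coordinates where
  -- `v` is negative.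
  set w : V → ℝ := fun i => max (v i) 0 with hwdef
  have hw : 0 ≤ w := fun i => le_max_right _ _
  obtain ⟨X, hX, hmax⟩ := h.exists_max_theta3Feasible w
  obtain ⟨x, hx, hxX⟩ := h.exists_mem_genTH_quad_le hw hX
  have h1 := h.dotProduct_le_of_mem_abl hw hmax hy
  have h2 : v ⬝ᵥ y ≤ w ⬝ᵥ y :=
    Finset.sum_le_sum fun i _ => mul_le_mul_of_nonneg_right (le_max_left _ _) (hy.1 i)
  set t : V → ℝ := fun i => if 0 ≤ v i then 1 else 0 with ht
  have h3 := hfT _ (h.mul_mem_genTH hx (t := t)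
    (fun i => by simp only [ht]; split_ifs <;> simp)
    (fun i => by simp only [ht]; split_ifs <;> simp))
  have h4 : v ⬝ᵥ (t * x) = w ⬝ᵥ x := by
    refine Finset.sum_congr rfl fun i _ => ?_
    simp only [ht, hwdef, Pi.mul_apply]
    split_ifs with h0
    · rw [one_mul, max_eq_left h0]
    · simp [max_eq_right (not_le.1 h0).le]
  rw [hf] at h3 hfy
  linarith

theorem zero_mem_dualBody (h : IsThetaPair A K) : (0 : V → ℝ) ∈ dualBody A K :=
  h.mem_dualBody_iff.2 ⟨0, zero_mem_dualCone, by simpa using zero_mem_dualCone⟩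

theorem nonneg_of_mem_closure_dualBody (h : IsThetaPair A K) {x : V → ℝ}
    (hx : x ∈ closure (dualBody A K)) : 0 ≤ x :=
  closure_minimal (fun _ => h.nonneg_of_mem_dualBody) isClosed_Ici hx

theorem exists_mem_closure_le [Nonempty V] (h : IsThetaPair A K) {w : V → ℝ} (hw : 0 ≤ w) {lam : ℝ}
    (hlam : ∀ X ∈ theta3Feasible A K, sqrtVec w ⬝ᵥ X *ᵥ sqrtVec w ≤ lam) :
    ∃ x ∈ closure (dualBody A K), ∀ i, w i ≤ lam * x i := by
  -- If the bound is zero then `w = 0`, since every feasible value of `theta2` dominates `w`;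
  -- otherwise `w / lam` is a limit of points `w / (lam + ε)` of the dual body.
  rcases (h.nonneg_of_theta3_bound hlam).eq_or_lt with h0 | hpos
  · refine ⟨0, subset_closure h.zero_mem_dualBody, fun i => ?_⟩
    rw [Pi.zero_apply, mul_zero, h0]
    refine le_of_forall_pos_le_add fun ε hε => ?_
    obtain ⟨Y, hY⟩ := h.exists_mem_theta2Feasible_add hlam hε
    exact h.le_of_mem_theta2Feasible hw hY i
  · refine ⟨lam⁻¹ • w, ?_, fun i => by simp [hpos.ne']⟩
    have hlim : Filter.Tendsto (fun ε : ℝ => (lam + ε)⁻¹ • w) (nhdsWithin 0 (Set.Ioi 0))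
        (nhds (lam⁻¹ • w)) := by
      have hc : ContinuousAt (fun ε : ℝ => (lam + ε)⁻¹ • w) 0 :=
        ((continuousAt_const.add continuousAt_id).inv₀ (by simpa using hpos.ne')).smul
          continuousAt_const
      simpa using hc.tendsto.mono_left nhdsWithin_le_nhds
    refine mem_closure_of_tendsto hlim ?_
    filter_upwards [self_mem_nhdsWithin] with ε hε
    exact h.inv_smul_add_mem_dualBody hw hlam hε

theorem theta_duality [Nonempty V] (h : IsThetaPair A K) {w : V → ℝ} (hw : 0 ≤ w) :
    (theta A K w = theta1 A K w ∧ theta1 A K w = theta2 A K w ∧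
      theta2 A K w = theta3 A K w ∧ theta3 A K w = theta4 A K w) ∧
    (∃ y ∈ abl (closure (dualBody A K)),
      IsMaxOn (linObj w) (abl (closure (dualBody A K))) y) ∧
    (∃ x ∈ closure (dualBody A K), IsMinOn (maxRatio w) (closure (dualBody A K)) x) ∧
    (IsClosed (dualBody A K) →
      ∃ p ∈ theta2Feasible A K w, IsMinOn Prod.fst (theta2Feasible A K w) p) ∧
    (∃ X ∈ theta3Feasible A K, IsMaxOn (quadObj w) (theta3Feasible A K) X) ∧
    (∃ x ∈ genTH A (psdLift K), IsMaxOn (linObj w) (genTH A (psdLift K)) x) := by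
  obtain ⟨X, hX, hmax⟩ := h.exists_max_theta3Feasible w
  obtain ⟨y, hy, hyX⟩ := h.exists_mem_genTH_quad_le hw hX
  obtain ⟨x, hx, hxle⟩ := h.exists_mem_closure_le hw hmax
  set lam := sqrtVec w ⬝ᵥ X *ᵥ sqrtVec w with hlam
  have hlam0 : 0 ≤ lam := h.nonneg_of_theta3_bound hmax
  have habl : abl (closure (dualBody A K)) = genTH A (psdLift K) := by
    rw [abl_closure, h.abl_dualBody]
  have hbody : ∀ z ∈ genTH A (psdLift K), w ⬝ᵥ z ≤ lam := fun z hz =>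
    h.dotProduct_le_of_mem_abl hw hmax (h.genTH_subset_abl hz)
  have hylam : w ⬝ᵥ y = lam := le_antisymm (hbody y hy) hyX
  have hratio : ∀ z ∈ closure (dualBody A K), (lam : EReal) ≤ maxRatio w z := fun z hz =>
    hylam ▸ dotProduct_le_maxRatio hw (h.nonneg_of_mem_closure_dualBody hz) hz (habl ▸ hy)
  have hxlam : maxRatio w x ≤ (lam : EReal) :=
    (maxRatio_le_coe_iff hw (h.nonneg_of_mem_closure_dualBody hx) hlam0).2 hxle
  have hfeas : ∀ p ∈ theta2Feasible A K w, lam ≤ p.1 := fun p hp =>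
    h.quad_le_of_mem_theta2Feasible hp hX
  have e4 : theta4 A K w = lam := by
    refine le_antisymm (iSup₂_le fun z hz => EReal.coe_le_coe_iff.2 (hbody z hz)) ?_
    exact hylam ▸ le_iSup₂ (f := fun z (_ : z ∈ genTH A (psdLift K)) => linObj w z) y hy
  have e0 : theta A K w = lam := by rw [theta, habl]; exact e4
  have e1 : theta1 A K w = lam :=
    le_antisymm ((iInf₂_le x hx).trans hxlam) (le_iInf₂ hratio)
  have e2 : theta2 A K w = lam := by
    refine le_antisymm (EReal.le_of_forall_lt_iff_le.1 fun z hz => ?_)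
      (le_iInf₂ fun p hp => EReal.coe_le_coe_iff.2 (hfeas p hp))
    -- Every real `z > lam` is feasible, by taking `ε = z - lam`.
    obtain ⟨Y, hY⟩ := h.exists_mem_theta2Feasible_add hmax
      (sub_pos.2 (EReal.coe_lt_coe_iff.1 hz))
    rw [add_sub_cancel] at hY
    exact iInf₂_le (f := fun p (_ : p ∈ theta2Feasible A K w) => (p.1 : EReal)) (z, Y) hY
  have e3 : theta3 A K w = lam := by
    refine le_antisymm (iSup₂_le fun Z hZ => EReal.coe_le_coe_iff.2 (hmax Z hZ)) ?_
    exact le_iSup₂ (f := fun Z (_ : Z ∈ theta3Feasible A K) => quadObj w Z) X hX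
  have hbest : IsMaxOn (linObj w) (genTH A (psdLift K)) y := fun z hz =>
    EReal.coe_le_coe_iff.2 ((hbody z hz).trans hyX)
  refine ⟨⟨e0.trans e1.symm, e1.trans e2.symm, e2.trans e3.symm, e3.trans e4.symm⟩,
    ⟨y, habl ▸ hy, habl ▸ hbest⟩, ⟨x, hx, fun z hz => hxlam.trans (hratio z hz)⟩,
    fun hcl => ?_, ⟨X, hX, fun Z hZ => EReal.coe_le_coe_iff.2 (hmax Z hZ)⟩, ⟨y, hy, hbest⟩⟩
  -- The optimal point `x` now lies in the dual body itself, so rescaling reaches `lam` exactly.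
  rw [hcl.closure_eq] at hx
  obtain ⟨Y, hY⟩ := h.exists_mem_theta2Feasible hw hx hxle hlam0
  exact ⟨(lam, Y), hY, fun p hp => hfeas p hp⟩

end IsThetaPair

/-! ### Sign-pattern cones and theta bodies of graphs. -/

section Graph

variable {V : Type*} [DecidableEq V]

theorem diagonal_mem_polyAdjCone {P N : Set (Sym2 V)}
    (hN : ∀ i, s(i, i) ∉ N) (hP : ∀ i, s(i, i) ∉ P) (d : V → ℝ) :
    diagonal d ∈ polyAdjCone P N := by
  refine ⟨isSymm_diagonal d, fun i j hij => ?_, fun i j hij => ?_⟩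
  · have : i ≠ j := by rintro rfl; exact hP i hij
    rw [diagonal_apply_ne _ this]
  · have : i ≠ j := by rintro rfl; exact hN i hij
    rw [diagonal_apply_ne _ this]

/-- The symmetrised matrix unit, the trace form against which reads off an entry. -/
def symUnit (i j : V) : Matrix V V ℝ := single i j 1 + single j i 1

theorem isSymm_symUnit (i j : V) : (symUnit i j).IsSymm := by
  rw [symUnit, Matrix.IsSymm, transpose_add, transpose_single, transpose_single, add_comm]

variable [Fintype V]

theorem diagScalingInvariant_polyAdjCone (P N : Set (Sym2 V)) :
    DiagScalingInvariant (polyAdjCone P N) := by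
  rintro h hh X ⟨hs, hP, hN⟩
  refine ⟨isSymm_diagonal_conj hs h, fun i j hij => ?_, fun i j hij => ?_⟩
  · rw [diagonal_mul_mul_diagonal_apply]
    exact mul_nonneg (mul_nonneg (hh i) (hP i j hij)) (hh j)
  · rw [diagonal_mul_mul_diagonal_apply]
    exact mul_nonpos_of_nonpos_of_nonneg
      (mul_nonpos_of_nonneg_of_nonpos (hh i) (hN i j hij)) (hh j)

theorem inp_symUnit {X : Matrix V V ℝ} (hX : X.IsSymm) (i j : V) :
    inp X (symUnit i j) = 2 * X i j := by
  have : ∀ a b, inp X (single a b 1) = X a b := fun a b => by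
    simp [inp_eq_sum, single_apply, ite_and]
  rw [symUnit, inp_add_right, this, this, hX.apply]
  ring

theorem isPolyhedralCone_polyAdjCone (P N : Set (Sym2 V)) :
    IsPolyhedralCone (polyAdjCone P N) := by
  refine ⟨(fun p : V × V => symUnit p.1 p.2) '' {p | s(p.1, p.2) ∈ P} ∪
    (fun p : V × V => -symUnit p.1 p.2) '' {p | s(p.1, p.2) ∈ N},
    ((Set.toFinite _).image _).union ((Set.toFinite _).image _), ?_, ?_⟩
  · rintro _ (⟨p, -, rfl⟩ | ⟨p, -, rfl⟩)
    · exact isSymm_symUnit _ _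
    · exact (isSymm_symUnit _ _).neg
  · ext X
    refine and_congr_right fun hX => ⟨?_, fun h => ⟨fun i j hij => ?_, fun i j hij => ?_⟩⟩
    · rintro ⟨hP, hN⟩ _ (⟨p, hp, rfl⟩ | ⟨p, hp, rfl⟩)
      · have := hP _ _ hp
        rw [inp_comm, inp_symUnit hX]
        linarith
      · have := hN _ _ hp
        rw [inp_comm, inp_neg_right, inp_symUnit hX]
        linarith
    · have := h _ (Or.inl ⟨(i, j), hij, rfl⟩)
      rw [inp_comm, inp_symUnit hX] at this
      linarith
    · have := h _ (Or.inr ⟨(i, j), hij, rfl⟩)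
      rw [inp_comm, inp_neg_right, inp_symUnit hX] at this
      linarith

theorem isThetaPair_polyAdjCone_psdCone {P N : Set (Sym2 V)}
    (hP : ∀ i, s(i, i) ∉ P) (hN : ∀ i, s(i, i) ∉ N) :
    IsThetaPair (polyAdjCone P N) (psdCone V) where
  polyhedral := isPolyhedralCone_polyAdjCone P N
  scaling_left := diagScalingInvariant_polyAdjCone P N
  diagonal_left := by
    rintro _ ⟨d, rfl⟩
    exact diagonal_mem_polyAdjCone hN hP d
  subset_psdCone := subset_rfl
  scaling_right := fun h _ _ hX => posSemidef_diagonal_conj hX h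
  isClosed := isClosed_psdCone
  convex := convex_psdCone
  diagonal_right := fun _ hd => Matrix.PosSemidef.diagonal hd

/-- The dual of a polyhedral adjacency cone is the one of the complementary sign patterns. -/
theorem adjDual_polyAdjCone {P N P' N' : Set (Sym2 V)}
    (hP : ∀ i j, s(i, j) ∈ P' ↔ i ≠ j ∧ s(i, j) ∉ P)
    (hN : ∀ i j, s(i, j) ∈ N' ↔ i ≠ j ∧ s(i, j) ∉ N) :
    adjDual (polyAdjCone P N) = polyAdjCone P' N' := by
  ext X
  constructor
  · rintro ⟨_, ⟨d, rfl⟩, Y, ⟨hYs, hY⟩, rfl⟩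
    have hYs : Y.IsSymm := hYs
    have hunit : ∀ i j a b : V, s(a, b) ≠ s(i, j) → symUnit i j a b = 0 := by
      intro i j a b hab
      rw [ne_eq, Sym2.eq_iff, not_or] at hab
      simp only [symUnit, Matrix.add_apply, single_apply]
      rw [if_neg (fun h => hab.1 ⟨h.1.symm, h.2.symm⟩),
        if_neg (fun h => hab.2 ⟨h.1.symm, h.2.symm⟩), add_zero]
    have hunit0 : ∀ i j a b : V, 0 ≤ symUnit i j a b := by
      intro i j a b
      simp only [symUnit, Matrix.add_apply, single_apply]
      split_ifs <;> norm_num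
    refine ⟨(isSymm_diagonal d).sub hYs, fun i j hij => ?_, fun i j hij => ?_⟩
    · obtain ⟨hne, hnP⟩ := (hP i j).1 hij
      -- Since `s(i, j) ∉ P`, the cone allows a negative entry there; testing `Y` against it gives
      -- `Y i j ≤ 0`.
      have h1 := hY (-symUnit i j) ⟨(isSymm_symUnit i j).neg, fun a b hab => ?_, fun a b hab => ?_⟩
      · rw [inp_comm, inp_neg_right, inp_symUnit hYs] at h1
        simp only [Matrix.sub_apply, diagonal_apply_ne _ hne]
        linarith
      · rw [Matrix.neg_apply, hunit i j a b (fun h => hnP (h ▸ hab)), neg_zero]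
      · rw [Matrix.neg_apply]
        exact neg_nonpos.2 (hunit0 i j a b)
    · obtain ⟨hne, hnN⟩ := (hN i j).1 hij
      have h1 := hY (symUnit i j) ⟨isSymm_symUnit i j, fun a b _ => hunit0 i j a b,
        fun a b hab => ?_⟩
      · rw [inp_comm, inp_symUnit hYs] at h1
        simp only [Matrix.sub_apply, diagonal_apply_ne _ hne]
        linarith
      · rw [hunit i j a b (fun h => hnN (h ▸ hab))]
  · rintro ⟨hs, hXP, hXN⟩
    have hs : X.IsSymm := hs
    refine ⟨diagonal X.diag, ⟨_, rfl⟩, diagonal X.diag - X,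
      ⟨(isSymm_diagonal _).sub hs, fun Z hZ => ?_⟩, sub_sub_cancel _ _⟩
    rw [inp_eq_sum]
    refine Finset.sum_nonneg fun i _ => Finset.sum_nonneg fun j _ => ?_
    rcases eq_or_ne i j with rfl | hne
    · simp
    rw [Matrix.sub_apply, diagonal_apply_ne _ hne, zero_sub]
    -- Each constraint absent on `Z i j` is present on `X i j`, so every product `Z i j * (-X i j)`
    -- is nonnegative.
    by_cases h1 : s(i, j) ∈ P <;> by_cases h2 : s(i, j) ∈ N
    · rw [le_antisymm (hZ.2.2 i j h2) (hZ.2.1 i j h1), zero_mul]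
    · exact mul_nonneg (hZ.2.1 i j h1) (neg_nonneg.2 (hXN i j ((hN i j).2 ⟨hne, h2⟩)))
    · exact mul_nonneg_of_nonpos_of_nonpos (hZ.2.2 i j h2)
        (neg_nonpos.2 (hXP i j ((hP i j).2 ⟨hne, h1⟩)))
    · rw [le_antisymm (hXN i j ((hN i j).2 ⟨hne, h2⟩)) (hXP i j ((hP i j).2 ⟨hne, h1⟩)), neg_zero,
        mul_zero]

/-- For `K = S₊`, self-duality and the Schur complement turn the dual body into an ordinary theta
body, and `adjDual` complements the sign patterns. -/
theorem abl_genTH_polyAdjCone [Nonempty V] {P N P' N' : Set (Sym2 V)}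
    (hP : ∀ i j, s(i, j) ∈ P' ↔ i ≠ j ∧ s(i, j) ∉ P)
    (hN : ∀ i j, s(i, j) ∈ N' ↔ i ≠ j ∧ s(i, j) ∉ N)
    (hPd : ∀ i, s(i, i) ∉ P) (hNd : ∀ i, s(i, i) ∉ N) :
    abl (genTH (polyAdjCone P' N') (psdCone (Option V)))
      = genTH (polyAdjCone P N) (psdCone (Option V)) := by
  have h := (isThetaPair_polyAdjCone_psdCone hPd hNd).abl_dualBody
  rwa [dualBody, dualCone_psdCone, genTH_schurLift_psdCone, psdLift_psdCone,
    adjDual_polyAdjCone hP hN] at h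

theorem abl_graphTH [Nonempty V] (G : SimpleGraph V) : abl (graphTH G) = graphTH Gᶜ := by
  have h : ∀ i j, s(i, j) ∈ G.edgeSet ↔ i ≠ j ∧ s(i, j) ∉ Gᶜ.edgeSet := fun i j => by
    simp only [SimpleGraph.mem_edgeSet, SimpleGraph.compl_adj]
    exact ⟨fun h => ⟨h.ne, fun h' => h'.2 h⟩, fun h => by tauto⟩
  exact abl_genTH_polyAdjCone h h (by simp) (by simp)

theorem abl_graphTHPrime [Nonempty V] (G : SimpleGraph V) :
    abl (graphTHPrime G) = graphTHPlus Gᶜ := by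
  refine abl_genTH_polyAdjCone (fun i j => ?_) (fun i j => ?_) (by simp) (by simp)
  · simp only [Set.mem_union, SimpleGraph.mem_edgeSet, SimpleGraph.compl_adj,
      Set.mem_empty_iff_false, not_false_eq_true, and_true]
    exact ⟨fun h => h.elim (fun h => h.ne) (fun h => h.1), fun h => by tauto⟩
  · simp only [SimpleGraph.mem_edgeSet, SimpleGraph.compl_adj]
    exact ⟨fun h => ⟨h.ne, fun h' => h'.2 h⟩, fun h => by tauto⟩

end Graph

end ThetaBody

theorem mainTheorem1 {V : Type*} [Fintype V] [DecidableEq V] [Nonempty V] :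
    (∀ A K : Set (Matrix V V ℝ),
      ThetaBody.IsPolyhedralCone A →
      ThetaBody.DiagScalingInvariant A →
      Set.range (Matrix.diagonal : (V → ℝ) → Matrix V V ℝ) ⊆ A →
      K ⊆ ThetaBody.psdCone V →
      ThetaBody.DiagScalingInvariant K →
      IsClosed K →
      Convex ℝ K →
      (∀ d : V → ℝ, 0 ≤ d → Matrix.diagonal d ∈ K) →
      ThetaBody.HasSymInterior K →
      (∀ w : V → ℝ, 0 ≤ w →
        (ThetaBody.theta A K w = ThetaBody.theta1 A K w ∧
          ThetaBody.theta1 A K w = ThetaBody.theta2 A K w ∧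
          ThetaBody.theta2 A K w = ThetaBody.theta3 A K w ∧
          ThetaBody.theta3 A K w = ThetaBody.theta4 A K w) ∧
        (∃ y ∈ ThetaBody.abl (closure (ThetaBody.dualBody A K)),
          IsMaxOn (ThetaBody.linObj w) (ThetaBody.abl (closure (ThetaBody.dualBody A K))) y) ∧
        (∃ x ∈ closure (ThetaBody.dualBody A K),
          IsMinOn (ThetaBody.maxRatio w) (closure (ThetaBody.dualBody A K)) x) ∧
        (IsClosed (ThetaBody.dualBody A K) →
          ∃ p ∈ ThetaBody.theta2Feasible A K w,
            IsMinOn Prod.fst (ThetaBody.theta2Feasible A K w) p) ∧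
        (∃ X ∈ ThetaBody.theta3Feasible A K,
          IsMaxOn (ThetaBody.quadObj w) (ThetaBody.theta3Feasible A K) X) ∧
        (∃ x ∈ ThetaBody.genTH A (ThetaBody.psdLift K),
          IsMaxOn (ThetaBody.linObj w) (ThetaBody.genTH A (ThetaBody.psdLift K)) x)) ∧
      ThetaBody.abl (closure (ThetaBody.dualBody A K))
        = ThetaBody.genTH A (ThetaBody.psdLift K)) ∧
    (∀ G : SimpleGraph V,
      ThetaBody.abl (ThetaBody.graphTH G) = ThetaBody.graphTH Gᶜ ∧
      ThetaBody.abl (ThetaBody.graphTHPrime G) = ThetaBody.graphTHPlus Gᶜ) := by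
  refine ⟨fun A K hA hAs hAd hKp hKs hKc hKv hKd _ => ?_,
    fun G => ⟨ThetaBody.abl_graphTH G, ThetaBody.abl_graphTHPrime G⟩⟩
  have h : ThetaBody.IsThetaPair A K := ⟨hA, hAs, hAd, hKp, hKs, hKc, hKv, hKd⟩
  exact ⟨fun w hw => h.theta_duality hw, by rw [ThetaBody.abl_closure, h.abl_dualBody]⟩
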